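/- Let $f,g,N\in\mathbb R$ be constants with $g\neq 0$, and consider the system for functions $\psi,v,\rho$ of $(t,x,z)$ $$\Delta\psi_t-g\rho_x-fv_z=\psi_x\Delta\psi_z-\psi_z\Delta\psi_x,\qquad v_t+f\psi_z=\psi_xv_z-\psi_zv_x,\qquad \rho_t+\tfrac{N^2}{g}\psi_x=\psi_x\rho_z-\psi_z\rho_x,$$ where $\Delta=D_x^2+D_z^2$. Let $U$ be a nonempty open convex subset of the space $\mathbb R^6$ of the variables $(t,x,z,\psi,v,\rho)$ (for example $U=\mathbb R^6$). An infinitesimal Lie point symmetry on $U$ is a $C^\infty$ vector field on $U$ whose third prolongation annihilates each of the three equations at all third-order jets over $U$ that satisfy the three equations together with their differential consequences of order at most three. (i) If $f\neq0$, the set of all infinitesimal Lie point symmetries on $U$ is the linear span of the following vector fields (restricted to $U$): $$X_1=\partial_v,\quad X_2=\partial_\rho,\quad X_3=a(t)\,\partial_\psi,\quad X_4=\partial_t,$$ $$X_5=b(t)\,[\partial_x-f\,\partial_v]+b'(t)\,z\,\partial_\psi,\qquad X_6=c(t)\Big[\partial_z+\tfrac{N^2}{g}\,\partial_\rho\Big]-c'(t)\,x\,\partial_\psi,$$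 $$X_7=x\,\partial_x+z\,\partial_z+v\,\partial_v+\rho\,\partial_\rho+2\psi\,\partial_\psi,$$ $$X_8=t\,\partial_t+2x\,\partial_x+2z\,\partial_z+3\psi\,\partial_\psi-2fx\,\partial_v+2\tfrac{N^2}{g}z\,\partial_\rho,$$ $$X_9=z\,\partial_x-x\,\partial_z-\tfrac1f\big[g\rho+(f^2-N^2)z\big]\partial_v+\tfrac1g\big[fv+(f^2-N^2)x\big]\partial_\rho,$$ where $a,b,c$ run over all $C^\infty$ functions of $t$ (defined on the projection of $U$ to the $t$-axis). (ii) If $f=0$, the set of all infinitesimal Lie point symmetries on $U$ is the linear span of $$X_1=h(v,\,g\rho-N^2z)\,\partial_v$$ and of the fields $X_2,\dots,X_8$ above taken with $f=0$, where $a,b,c$ are as in (i) and $h$ runs over all $C^\infty$ functions of two variables (defined on the image of $U$ under $(v,\,g\rho-N^2z)$). In both cases this span is closed under the commutator of vector fields and is an infinite-dimensional Lie algebra. -/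

import Mathlib

open scoped ContDiff

namespace InternalWaves

/-- The space of independent variables `(t, x, z)`, with indices `0, 1, 2`. -/
abbrev Base : Type := Fin 3 → ℝ

/-- The space of dependent variables `(ψ, v, ρ)`, with indices `0, 1, 2`. -/
abbrev Fibre : Type := Fin 3 → ℝ

/-- The space of all variables `(t, x, z; ψ, v, ρ)`, on which point symmetries act. -/
abbrev Total : Type := Base × Fibre

/-- A value of a jet: the base point, and for each dependent variable `α` and each list
`I = [i₁, …, iₖ]` of independent variables the value of `∂_{i₁} ⋯ ∂_{iₖ} u^α`. -/
abbrev Jet : Type := Base × (Fin 3 → List (Fin 3) → ℝ)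

/-- The partial derivative `∂_i w`. -/
noncomputable def pd (i : Fin 3) (w : Base → ℝ) : Base → ℝ :=
  fun p => fderiv ℝ w p (Pi.single i 1)

/-- The iterated partial derivative `∂_I w = ∂_{i₁} ⋯ ∂_{iₖ} w` for `I = [i₁, …, iₖ]`. -/
noncomputable def pdList : List (Fin 3) → (Base → ℝ) → Base → ℝ
  | [], w => w
  | i :: I, w => pd i (pdList I w)

/-- The jet at `p` of the functions `u = (ψ, v, ρ)`. -/
noncomputable def jet (u : Base → Fibre) (p : Base) : Jet :=
  (p, fun α I => pdList I (fun q => u q α) p)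

/-- The left-hand sides minus the right-hand sides of
`Δψ_t - g ρ_x - f v_z = ψ_x Δψ_z - ψ_z Δψ_x`,
`v_t + f ψ_z = ψ_x v_z - ψ_z v_x`,
`ρ_t + (N²/g) ψ_x = ψ_x ρ_z - ψ_z ρ_x`,
as functions of the jet, where `Δ = D_x² + D_z²`. -/
noncomputable def system (f g N : ℝ) (k : Fin 3) (j : Jet) : ℝ :=
  let ψ := j.2 0
  let v := j.2 1
  let ρ := j.2 2
  ![(ψ [0, 1, 1] + ψ [0, 2, 2]) - g * ρ [1] - f * v [2]
      - (ψ [1] * (ψ [2, 1, 1] + ψ [2, 2, 2]) - ψ [2] * (ψ [1, 1, 1] + ψ [1, 2, 2])),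
    v [0] + f * ψ [2] - (ψ [1] * v [2] - ψ [2] * v [1]),
    ρ [0] + N ^ 2 / g * ψ [1] - (ψ [1] * ρ [2] - ψ [2] * ρ [1])] k

/-- The orders of the three equations. -/
def systemOrder : Fin 3 → ℕ := ![3, 1, 1]

/-- The third-order jet of `u` at `p` satisfies the system: the three equations and all their
differential consequences of order at most three (the order of the system) hold at `p`. -/
def SolvesAt (f g N : ℝ) (u : Base → Fibre) (p : Base) : Prop :=
  ∀ (k : Fin 3) (I : List (Fin 3)), systemOrder k + I.length ≤ 3 →
    pdList I (fun q => system f g N k (jet u q)) p = 0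

/-- The characteristic `Q^α = η^α - ∑_j ξ^j u^α_j` of the vector field
`X = ∑_j ξ^j ∂/∂x^j + ∑_α η^α ∂/∂u^α`, along the graph of `u`. -/
noncomputable def characteristic (X : Total → Total) (u : Base → Fibre) (α : Fin 3) :
    Base → ℝ :=
  fun q => (X (q, u q)).2 α - ∑ j, (X (q, u q)).1 j * pd j (fun r => u r α) q

/-- The prolongation of `X` at the jet of `u` at `p`: the `u^α_I`-component is
`D_I Q^α + ∑_j ξ^j u^α_{I,j}`. A total derivative `D_i`, evaluated on the jet of `u`, is the
partial derivative `∂_i` of the function evaluated along `u`. -/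
noncomputable def prolong (X : Total → Total) (u : Base → Fibre) (p : Base) : Jet :=
  ((X (p, u p)).1, fun α I => pdList I (characteristic X u α) p
    + ∑ j, (X (p, u p)).1 j * pdList (j :: I) (fun q => u q α) p)

/-- The infinitesimal invariance criterion on the open set `U`: the prolongation of `X`
annihilates each of the equations at every third-order jet, lying over a point of `U`, that
satisfies the system. -/
def IsAdmitted (f g N : ℝ) (U : Set Total) (X : Total → Total) : Prop :=
  ∀ u : Base → Fibre, ContDiff ℝ ∞ u → ∀ p : Base, (p, u p) ∈ U → SolvesAt f g N u p →
    ∀ k : Fin 3, deriv (fun s : ℝ => system f g N k (jet u p + s • prolong X u p)) 0 = 0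

/-- The set of all infinitesimal Lie point symmetries, with smooth coefficients, on the open set
`U`. A vector field on `U` is represented by its extension by zero to the whole space. -/
def symmetryAlgebra (f g N : ℝ) (U : Set Total) : Set (Total → Total) :=
  {X | ContDiffOn ℝ ∞ X U ∧ (∀ m, m ∉ U → X m = 0) ∧ IsAdmitted f g N U X}

/-- The vector field `τ ∂_t + ξ ∂_x + ζ ∂_z + φ ∂_ψ + μ ∂_v + σ ∂_ρ` on `U`, extended by zero,
where the coefficients are given as functions of `t, x, z, ψ, v, ρ`. -/
noncomputable def field (U : Set Total) (c : ℝ → ℝ → ℝ → ℝ → ℝ → ℝ → Total) :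
    Total → Total :=
  U.indicator fun m => c (m.1 0) (m.1 1) (m.1 2) (m.2 0) (m.2 1) (m.2 2)

/-- The smooth functions of time, defined at the times that occur in `U`. -/
def TimeFunction (U : Set Total) (a : ℝ → ℝ) : Prop :=
  ContDiffOn ℝ ∞ a ((fun m : Total => m.1 0) '' U)

/-- The operators that do not involve `h` or rotations and have the same form for all `f`:
`X₂, …, X₈` of both lists. -/
inductive Common (f g N : ℝ) (U : Set Total) : (Total → Total) → Prop
  | X2 : Common f g N U (field U fun _ _ _ _ _ _ => (![0, 0, 0], ![0, 0, 1]))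
  | X3 (a : ℝ → ℝ) (ha : TimeFunction U a) :
      Common f g N U (field U fun t _ _ _ _ _ => (![0, 0, 0], ![a t, 0, 0]))
  | X4 : Common f g N U (field U fun _ _ _ _ _ _ => (![1, 0, 0], ![0, 0, 0]))
  | X5 (b : ℝ → ℝ) (hb : TimeFunction U b) :
      Common f g N U (field U fun t _ z _ _ _ =>
        (![0, b t, 0], ![deriv b t * z, -(f * b t), 0]))
  | X6 (c : ℝ → ℝ) (hc : TimeFunction U c) :
      Common f g N U (field U fun t x _ _ _ _ =>
        (![0, 0, c t], ![-(deriv c t * x), 0, N ^ 2 / g * c t]))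
  | X7 : Common f g N U (field U fun _ x z ψ v ρ => (![0, x, z], ![2 * ψ, v, ρ]))
  | X8 : Common f g N U (field U fun t x z ψ _ _ =>
        (![t, 2 * x, 2 * z], ![3 * ψ, -(2 * f * x), 2 * (N ^ 2 / g) * z]))

/-- The operators `X₁, …, X₉` in the case `f ≠ 0`. -/
inductive Generator (f g N : ℝ) (U : Set Total) : (Total → Total) → Prop
  | X1 : Generator f g N U (field U fun _ _ _ _ _ _ => (![0, 0, 0], ![0, 1, 0]))
  | common (X : Total → Total) (hX : Common f g N U X) : Generator f g N U X
  | X9 : Generator f g N U (field U fun _ x z _ v ρ =>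
      (![0, z, -x], ![0, -(1 / f * (g * ρ + (f ^ 2 - N ^ 2) * z)),
        1 / g * (f * v + (f ^ 2 - N ^ 2) * x)]))

/-- The operators `X₁, …, X₈` in the case `f = 0`; here `X₁ = h(v, gρ - N²z) ∂_v`. -/
inductive GeneratorZero (g N : ℝ) (U : Set Total) : (Total → Total) → Prop
  | X1 (h : ℝ × ℝ → ℝ)
      (hh : ContDiffOn ℝ ∞ h ((fun m : Total => (m.2 1, g * m.2 2 - N ^ 2 * m.1 2)) '' U)) :
      GeneratorZero g N U (field U fun _ _ z _ v ρ =>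
        (![0, 0, 0], ![0, h (v, g * ρ - N ^ 2 * z), 0]))
  | common (X : Total → Total) (hX : Common 0 g N U X) : GeneratorZero g N U X

/-- The linear span of the operators `X₁, …, X₉` (case `f ≠ 0`). -/
noncomputable def algebra (f g N : ℝ) (U : Set Total) : Submodule ℝ (Total → Total) :=
  Submodule.span ℝ {X | Generator f g N U X}

/-- The linear span of the operators `X₁, …, X₈` (case `f = 0`). -/
noncomputable def algebraZero (g N : ℝ) (U : Set Total) : Submodule ℝ (Total → Total) :=
  Submodule.span ℝ {X | GeneratorZero g N U X}

/-- A linear space of vector fields is an infinite-dimensional Lie algebra with respect to the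
commutator of vector fields. -/
def IsInfiniteLieAlgebra (L : Submodule ℝ (Total → Total)) : Prop :=
  (∀ X ∈ L, ∀ Y ∈ L, VectorField.lieBracket ℝ X Y ∈ L) ∧ ¬ FiniteDimensional ℝ L

end InternalWaves

set_option linter.unusedSimpArgs false

/-! In the variables V = v + f x and R = ρ - (N²/g) z the last two equations say that V and R are
transported by the flow, V_t = ∂(ψ,V)/∂(x,z) and R_t = ∂(ψ,R)/∂(x,z). The first becomes Δψ_t - g R_x
- f V_z = ∂(ψ,Δψ)/∂(x,z), so N disappears. A vector field is written with components T (along t, x,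
z), Φ (along ψ), M (along V) and S (along R). Its prolongation applied to the system is the
linearized operator on the characteristics plus ∑ ξ^j D_j of the equations (`deriv_system_prolong`).

Necessity. On an exact solution the second summand vanishes. Instead of splitting a general
determining identity, one tests invariance at each point of U on a few families of explicit
polynomial solutions through that point and compares coefficients of their parameters. Solutions
affine in ψ, together with harmonic ψ over constant V and R, give `TransportEqs`: M and S depend on
V and R only, T and Φ do not depend on V and R, T⁰ depends on t only, and (T¹, T²) satisfies the
Cauchy–Riemann equations. Shear flows driven by R_x or V_z, and states of rest with V linear in x
and R linear in z, give `VorticityEqs`. Commuting mixed derivatives then shows that ∂_t T⁰, ∂_x T¹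
and ∂_z T¹ are constants, and integration over the convex set U yields the normal form `normalField`
(`IsAdmitted.isNormal`). Its data are five constants, three functions of t and a function H of the
conserved pair (V, gR), with f H₁ = f α and f H₂ = -κ, where κ is the rotation rate. These two
conditions contain the dichotomy: for f ≠ 0 they make H affine, while for f = 0 they forbid rotation
and leave H free.

Sufficiency. For a field of normal form the invariance expression is a linear combination of the
three equations at the point (`linEqn_normal`).

Conclusion. The fields of normal form are exactly the span of the generators in either case. They
are closed under the commutator by direct computation (`IsNormal.lieBracket`), and the fields a(t)
∂_ψ with polynomial a make the algebra infinite-dimensional. -/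

namespace InternalWaves

/-! ### Smooth functions as an algebra with commuting derivations. -/

section SmoothFunctions

variable {E F : Type*} [NormedAddCommGroup E] [NormedSpace ℝ E]
  [NormedAddCommGroup F] [NormedSpace ℝ F]

/-- The algebra of smooth real functions on `E`. -/
def Smooth (E : Type*) [NormedAddCommGroup E] [NormedSpace ℝ E] : Subalgebra ℝ (E → ℝ) where
  carrier := {w | ContDiff ℝ ∞ w}
  mul_mem' {w w'} (ha : ContDiff ℝ ∞ w) (hb : ContDiff ℝ ∞ w') := ContDiff.mul ha hb
  add_mem' {w w'} (ha : ContDiff ℝ ∞ w) (hb : ContDiff ℝ ∞ w') := ContDiff.add ha hb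
  algebraMap_mem' c := (contDiff_const : ContDiff ℝ ∞ fun _ : E => c)

theorem Smooth.contDiff (w : Smooth E) : ContDiff ℝ ∞ w.1 := w.2

/-- The derivative of a smooth function in the constant direction `e`. -/
noncomputable def dir (e : E) (w : Smooth E) : Smooth E :=
  ⟨fun p => fderiv ℝ w.1 p e,
    ((Smooth.contDiff w).fderiv_right (m := ∞) (by simp)).clm_apply contDiff_const⟩

/-- Evaluation of smooth functions at a point. -/
def ev (p : E) : Smooth E →ₐ[ℝ] ℝ where
  toFun w := w.1 p
  map_one' := rfl
  map_mul' _ _ := rfl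
  map_zero' := rfl
  map_add' _ _ := rfl
  commutes' _ := rfl

theorem ev_apply (p : E) (w : Smooth E) : ev p w = w.1 p := rfl

theorem Smooth.ext_ev {w w' : Smooth E} (h : ∀ p, ev p w = ev p w') : w = w' :=
  Subtype.ext (funext h)

theorem Smooth.differentiable (w : Smooth E) : Differentiable ℝ w.1 :=
  ContDiff.differentiable (Smooth.contDiff w) (by simp)

theorem ev_dir (p e : E) (w : Smooth E) : ev p (dir e w) = fderiv ℝ w.1 p e := rfl

theorem dir_add (e : E) (w w' : Smooth E) : dir e (w + w') = dir e w + dir e w' :=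
  Smooth.ext_ev fun p => by
    have h := fderiv_add (Smooth.differentiable w p) (Smooth.differentiable w' p)
    exact congrArg (fun T : E →L[ℝ] ℝ => T e) h

theorem dir_mul (e : E) (w w' : Smooth E) :
    dir e (w * w') = dir e w * w' + w * dir e w' :=
  Smooth.ext_ev fun p => by
    have h := fderiv_mul (Smooth.differentiable w p) (Smooth.differentiable w' p)
    have h2 := congrArg (fun T : E →L[ℝ] ℝ => T e) h
    simp only [map_add, map_mul, ev_dir]
    refine h2.trans ?_
    simp [ev_apply]; ring

theorem dir_algebraMap (e : E) (c : ℝ) : dir e (algebraMap ℝ (Smooth E) c) = 0 :=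
  Smooth.ext_ev fun p => by
    have h : fderiv ℝ (fun _ : E => c) p = 0 := fderiv_const_apply c
    exact congrArg (fun T : E →L[ℝ] ℝ => T e) h

theorem dir_one (e : E) : dir e (1 : Smooth E) = 0 := by
  simpa using dir_algebraMap e 1

theorem dir_zero (e : E) : dir e (0 : Smooth E) = 0 := by
  simpa using dir_algebraMap e 0

theorem dir_neg (e : E) (w : Smooth E) : dir e (-w) = -dir e w :=
  eq_neg_of_add_eq_zero_left (by rw [← dir_add, neg_add_cancel, dir_zero])

theorem dir_sub (e : E) (w w' : Smooth E) : dir e (w - w') = dir e w - dir e w' := by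
  rw [sub_eq_add_neg, dir_add, dir_neg, sub_eq_add_neg]

theorem dir_comm (e e' : E) (w : Smooth E) : dir e (dir e' w) = dir e' (dir e w) :=
  Smooth.ext_ev fun p => by
    have hw : ContDiff ℝ ∞ w.1 := w.2
    have hd : DifferentiableAt ℝ (fderiv ℝ w.1) p :=
      (ContDiff.fderiv_right (m := 1) hw (by norm_cast)).differentiable (by simp) p
    have hs : IsSymmSndFDerivAt ℝ w.1 p :=
      hw.contDiffAt.isSymmSndFDerivAt (by simp; norm_cast)
    have key : ∀ a b : E, ev p (dir a (dir b w)) = fderiv ℝ (fderiv ℝ w.1) p a b := by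
      intro a b
      have h := fderiv_clm_apply hd (differentiableAt_const b)
      have h2 := congrArg (fun T : E →L[ℝ] ℝ => T a) h
      refine Eq.trans h2 ?_
      simp
    rw [key, key]
    exact hs e e'

/-- The smooth function given by a continuous linear functional. -/
def linFun (L : E →L[ℝ] ℝ) : Smooth E := ⟨L, (L.contDiff : ContDiff ℝ ∞ L)⟩

theorem dir_linFun (e : E) (L : E →L[ℝ] ℝ) :
    dir e (linFun L) = algebraMap ℝ (Smooth E) (L e) :=
  Smooth.ext_ev fun p => by
    have h : fderiv ℝ (L : E → ℝ) p = L := L.fderiv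
    exact congrArg (fun T : E →L[ℝ] ℝ => T e) h

/-- Pull-back of smooth functions. -/
def pullback (j : E → F) (hj : ContDiff ℝ ∞ j) : Smooth F →ₐ[ℝ] Smooth E where
  toFun w := ⟨fun p => w.1 (j p), ContDiff.comp (Smooth.contDiff w) hj⟩
  map_one' := rfl
  map_mul' _ _ := rfl
  map_zero' := rfl
  map_add' _ _ := rfl
  commutes' _ := rfl

theorem ev_dir_pullback (j : E → F) (hj : ContDiff ℝ ∞ j) (p e : E) (w : Smooth F) :
    ev p (dir e (pullback j hj w)) = fderiv ℝ w.1 (j p) (fderiv ℝ j p e) := by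
  have h := fderiv_comp p (Smooth.differentiable w (j p)) ((hj.differentiable (by simp)) p)
  exact congrArg (fun T : E →L[ℝ] ℝ => T e) h

end SmoothFunctions

/-- A function which is smooth on an open set coincides near each of its points with a smooth
function. -/
theorem exists_contDiff_eventuallyEq {E F : Type*} [NormedAddCommGroup E] [NormedSpace ℝ E]
    [HasContDiffBump E] [FiniteDimensional ℝ E] [NormedAddCommGroup F] [NormedSpace ℝ F]
    {U : Set E} (hU : IsOpen U) {X : E → F} (hX : ContDiffOn ℝ ∞ X U) {m : E} (hm : m ∈ U) :
    ∃ Y : E → F, ContDiff ℝ ∞ Y ∧ Y =ᶠ[nhds m] X := by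
  obtain ⟨r, hr, hrU⟩ := Metric.isOpen_iff.1 hU m hm
  let χ : ContDiffBump m := ⟨r / 4, r / 2, by positivity, by linarith⟩
  -- A bump function equal to 1 near m and supported in a closed ball inside U extends the germ to
  -- the whole space.
  refine ⟨fun y => χ y • X y, ?_, ?_⟩
  · rw [contDiff_iff_contDiffAt]
    intro y
    by_cases hy : y ∈ U
    · exact χ.contDiff.contDiffAt.smul (hX.contDiffAt (hU.mem_nhds hy))
    · have hy' : y ∉ Metric.closedBall m (r / 2) := fun h =>
        hy (hrU (Metric.closedBall_subset_ball (by linarith) h))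
      have : (fun y => χ y • X y) =ᶠ[nhds y] fun _ => 0 := by
        filter_upwards [Metric.isClosed_closedBall.isOpen_compl.mem_nhds hy'] with q hq
        have : χ q = 0 := χ.zero_of_le_dist (by
          have : ¬ dist q m ≤ r / 2 := hq
          exact (not_le.1 this).le)
        simp [this]
      exact contDiffAt_const.congr_of_eventuallyEq this
  · filter_upwards [χ.eventuallyEq_one] with y hy
    simp [hy]

/-- The partial derivative of a smooth function of `(t, x, z)`. -/
noncomputable def D (i : Fin 3) (w : Smooth Base) : Smooth Base := dir (Pi.single i 1) w

/-- The iterated partial derivative of a smooth function of `(t, x, z)`. -/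
noncomputable def DList : List (Fin 3) → Smooth Base → Smooth Base
  | [], w => w
  | i :: I, w => D i (DList I w)

theorem pdList_coe (I : List (Fin 3)) (w : Smooth Base) : pdList I w.1 = (DList I w).1 := by
  induction I with
  | nil => rfl
  | cons i I ih => rw [pdList, ih]; rfl

theorem pdList_congr {w w' : Base → ℝ} {p : Base} (h : w =ᶠ[nhds p] w') (I : List (Fin 3)) :
    pdList I w =ᶠ[nhds p] pdList I w' := by
  induction I with
  | nil => exact h
  | cons i I ih =>
    filter_upwards [ih.fderiv (𝕜 := ℝ)] with q hq
    simp only [pdList, pd, hq]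

theorem D_add (i : Fin 3) (w w' : Smooth Base) : D i (w + w') = D i w + D i w' := dir_add _ _ _
theorem D_sub (i : Fin 3) (w w' : Smooth Base) : D i (w - w') = D i w - D i w' := dir_sub _ _ _
theorem D_neg (i : Fin 3) (w : Smooth Base) : D i (-w) = -D i w := dir_neg _ _
theorem D_zero (i : Fin 3) : D i 0 = 0 := dir_zero _
theorem D_mul (i : Fin 3) (w w' : Smooth Base) : D i (w * w') = D i w * w' + w * D i w' :=
  dir_mul _ _ _

/-- Constant functions of `(t, x, z)`. -/
noncomputable def C (c : ℝ) : Smooth Base := algebraMap ℝ _ c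

theorem ev_C (p : Base) (c : ℝ) : ev p (C c) = c := (ev p).commutes c

theorem D_C (i : Fin 3) (c : ℝ) : D i (C c) = 0 := dir_algebraMap _ _

/-- Used as rewrite rules, these three sort iterated derivatives so that the smallest index stands
outermost. Mixed derivatives then coincide syntactically, and differential identities become
polynomial identities. -/
theorem D_comm10 (w : Smooth Base) : D 1 (D 0 w) = D 0 (D 1 w) := dir_comm _ _ _
theorem D_comm20 (w : Smooth Base) : D 2 (D 0 w) = D 0 (D 2 w) := dir_comm _ _ _
theorem D_comm21 (w : Smooth Base) : D 2 (D 1 w) = D 1 (D 2 w) := dir_comm _ _ _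

/-- The coordinate functions on the space of `(t, x, z)`. -/
noncomputable def coord (i : Fin 3) : Smooth Base := linFun (ContinuousLinearMap.proj i)

theorem ev_coord (p : Base) (i : Fin 3) : ev p (coord i) = p i := rfl

theorem D_coord (i j : Fin 3) : D i (coord j) = C (if i = j then 1 else 0) := by
  rw [D, coord, dir_linFun]
  by_cases h : i = j
  · subst h; simp [C]
  · simp [C, h, Ne.symm h]

/-! ### The system in the variables ψ, V, R, and its linearization. -/

/-- The functions `(ψ, v, ρ)` expressed by `ψ`, `V = v + f x` and `R = ρ - (N²/g) z`. -/
noncomputable def state (f g N : ℝ) (ψ V R : Smooth Base) : Fin 3 → Smooth Base :=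
  ![ψ, V - C f * coord 1, R + C (N ^ 2 / g) * coord 2]

/-- The map `q ↦ u(q)` given by three smooth functions. -/
def toMap (u : Fin 3 → Smooth Base) : Base → Fibre := fun q α => (u α).1 q

theorem contDiff_toMap (u : Fin 3 → Smooth Base) : ContDiff ℝ ∞ (toMap u) :=
  contDiff_pi.2 fun α => Smooth.contDiff (u α)

theorem contDiff_graph (u : Fin 3 → Smooth Base) :
    ContDiff ℝ ∞ fun q : Base => ((q, toMap u q) : Total) :=
  contDiff_id.prodMk (contDiff_toMap u)

/-- Substitution of `u` into a function of all variables. -/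
noncomputable def subst (u : Fin 3 → Smooth Base) : Smooth Total →ₐ[ℝ] Smooth Base :=
  pullback _ (contDiff_graph u)

theorem ev_subst (u : Fin 3 → Smooth Base) (p : Base) (F : Smooth Total) :
    ev p (subst u F) = ev (p, toMap u p) F := rfl

/-- The Laplacian in `(x, z)`. -/
noncomputable def lap (w : Smooth Base) : Smooth Base := D 1 (D 1 w) + D 2 (D 2 w)

/-- The Jacobian `∂(a, b)/∂(x, z)`. -/
noncomputable def jac (a b : Smooth Base) : Smooth Base := D 1 a * D 2 b - D 2 a * D 1 b

/-- The system in terms of `ψ`, `V` and `R`. -/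
noncomputable def eqn (f g : ℝ) (ψ V R : Smooth Base) : Fin 3 → Smooth Base :=
  ![D 0 (lap ψ) - C g * D 1 R - C f * D 2 V - jac ψ (lap ψ),
    D 0 V - jac ψ V, D 0 R - jac ψ R]

/-- The linearization of the system at `(ψ, V, R)`. -/
noncomputable def linEqn (f g : ℝ) (ψ V R q₀ q₁ q₂ : Smooth Base) : Fin 3 → Smooth Base :=
  ![D 0 (lap q₀) - C g * D 1 q₂ - C f * D 2 q₁ - jac q₀ (lap ψ) - jac ψ (lap q₀),
    D 0 q₁ - jac q₀ V - jac ψ q₁, D 0 q₂ - jac q₀ R - jac ψ q₂]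

theorem system_state (f g N : ℝ) (hg : g ≠ 0) (ψ V R : Smooth Base) (k : Fin 3) :
    (fun q => system f g N k (jet (toMap (state f g N ψ V R)) q)) = (eqn f g ψ V R k).1 := by
  funext q
  have h : ∀ α I, (jet (toMap (state f g N ψ V R)) q).2 α I
      = ev q (DList I (state f g N ψ V R α)) := fun α I =>
    congrFun (pdList_coe I (state f g N ψ V R α)) q
  rw [← ev_apply]
  fin_cases k <;>
  simp only [system, h] <;>
  simp [DList, state, eqn, lap, jac, D_add, D_sub, D_mul, D_C, D_coord, ev_C,
    D_comm21] <;>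
  (try field_simp) <;> ring

theorem SolvesAt.eqn_eq_zero {f g N : ℝ} (hg : g ≠ 0) {ψ V R : Smooth Base} {p : Base}
    (h : SolvesAt f g N (toMap (state f g N ψ V R)) p) (k : Fin 3) :
    ev p (eqn f g ψ V R k) = 0 := by
  have := h k [] (by fin_cases k <;> simp [systemOrder])
  rw [system_state f g N hg] at this
  exact this

theorem solvesAt_of_eqn {f g N : ℝ} (hg : g ≠ 0) {ψ V R : Smooth Base} (p : Base)
    (h : ∀ k, eqn f g ψ V R k = 0) : SolvesAt f g N (toMap (state f g N ψ V R)) p := by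
  intro k I _
  have : ∀ I, DList I 0 = 0 := fun I => by
    induction I with
    | nil => rfl
    | cons i I ih => rw [DList, ih, D_zero]
  rw [system_state f g N hg, h k, pdList_coe, ← ev_apply, this, map_zero]

theorem deriv_quadratic (a b c : ℝ) : deriv (fun s : ℝ => a + s * b + s ^ 2 * c) 0 = b := by
  have h : HasDerivAt (fun s : ℝ => a + s * b + s ^ 2 * c) (1 * b + (2 * 0 ^ 1 * 1) * c) 0 := by
    have h1 := (hasDerivAt_id (0 : ℝ)).mul_const b
    have h2 := ((hasDerivAt_id (0 : ℝ)).pow 2).mul_const c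
    exact (h1.const_add a).add h2
  simpa using h.deriv

/-- Each equation has degree at most two in the jet, so its expansion in s stops at s², and the
derivative at 0 is the polarized linear term. The explicit s² coefficient supplied in each case is
the Jacobian part evaluated on K alone. -/
theorem deriv_system (f g N : ℝ) (J K : Jet) (k : Fin 3) :
    deriv (fun s : ℝ => system f g N k (J + s • K)) 0 =
      ![K.2 0 [0, 1, 1] + K.2 0 [0, 2, 2] - g * K.2 2 [1] - f * K.2 1 [2]
        - (K.2 0 [1] * (J.2 0 [2, 1, 1] + J.2 0 [2, 2, 2])
          + J.2 0 [1] * (K.2 0 [2, 1, 1] + K.2 0 [2, 2, 2])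
          - K.2 0 [2] * (J.2 0 [1, 1, 1] + J.2 0 [1, 2, 2])
          - J.2 0 [2] * (K.2 0 [1, 1, 1] + K.2 0 [1, 2, 2])),
        K.2 1 [0] + f * K.2 0 [2] - (K.2 0 [1] * J.2 1 [2] + J.2 0 [1] * K.2 1 [2]
          - K.2 0 [2] * J.2 1 [1] - J.2 0 [2] * K.2 1 [1]),
        K.2 2 [0] + N ^ 2 / g * K.2 0 [1] - (K.2 0 [1] * J.2 2 [2] + J.2 0 [1] * K.2 2 [2]
          - K.2 0 [2] * J.2 2 [1] - J.2 0 [2] * K.2 2 [1])] k := by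
  fin_cases k
  · refine Eq.trans (congrArg (fun F : ℝ → ℝ => deriv F 0) (funext fun s => ?_))
      (deriv_quadratic (system f g N 0 J) _
        (-(K.2 0 [1] * (K.2 0 [2, 1, 1] + K.2 0 [2, 2, 2])
          - K.2 0 [2] * (K.2 0 [1, 1, 1] + K.2 0 [1, 2, 2]))))
    simp [system]; ring
  · refine Eq.trans (congrArg (fun F : ℝ → ℝ => deriv F 0) (funext fun s => ?_))
      (deriv_quadratic (system f g N 1 J) _
        (-(K.2 0 [1] * K.2 1 [2] - K.2 0 [2] * K.2 1 [1])))
    simp [system]; ring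
  · refine Eq.trans (congrArg (fun F : ℝ → ℝ => deriv F 0) (funext fun s => ?_))
      (deriv_quadratic (system f g N 2 J) _
        (-(K.2 0 [1] * K.2 2 [2] - K.2 0 [2] * K.2 2 [1])))
    simp [system]; ring

/-- The characteristic of a vector field with components `ξ` and `η` along `w`. -/
noncomputable def char (ξ : Fin 3 → Smooth Base) (η w : Smooth Base) : Smooth Base :=
  η - (ξ 0 * D 0 w + ξ 1 * D 1 w + ξ 2 * D 2 w)

/-- The prolongation splits into the evolutionary field of the characteristics and the total
derivative ∑ ξ^j D_j. The former acts on the equations by their linearization, the latter by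
differentiating them along u. The shifts of M and S by ξ¹ and ξ² convert the components along v and
ρ to those along V and R. Agreement near p suffices because only derivatives at p enter. -/
theorem deriv_system_prolong (f g N : ℝ) (hg : g ≠ 0) (X : Total → Total)
    (ψ V R : Smooth Base) (p : Base) (ξ : Fin 3 → Smooth Base) (φ M S : Smooth Base)
    (hξ : ∀ j, (fun q => (X (q, toMap (state f g N ψ V R) q)).1 j) =ᶠ[nhds p] (ξ j).1)
    (hη : ∀ α, (fun q => (X (q, toMap (state f g N ψ V R) q)).2 α) =ᶠ[nhds p]
      (![φ, M - C f * ξ 1, S + C (N ^ 2 / g) * ξ 2] α : Smooth Base).1) (k : Fin 3) :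
    deriv (fun s : ℝ => system f g N k (jet (toMap (state f g N ψ V R)) p
        + s • prolong X (toMap (state f g N ψ V R)) p)) 0 =
      ev p (linEqn f g ψ V R (char ξ φ ψ) (char ξ M V) (char ξ S R) k)
      + (ev p (ξ 0) * ev p (D 0 (eqn f g ψ V R k)) + ev p (ξ 1) * ev p (D 1 (eqn f g ψ V R k))
        + ev p (ξ 2) * ev p (D 2 (eqn f g ψ V R k))) := by
  set u := state f g N ψ V R with hu
  have hJ : ∀ α I, (jet (toMap u) p).2 α I = ev p (DList I (u α)) := fun α I =>
    congrFun (pdList_coe I (u α)) p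
  have hQ : ∀ α, characteristic X (toMap u) α =ᶠ[nhds p]
      (![char ξ φ ψ, char ξ M V, char ξ S R] α : Smooth Base).1 := by
    intro α
    filter_upwards [hη α, hξ 0, hξ 1, hξ 2] with q h h0 h1 h2
    have hd : ∀ j, pd j (fun r => toMap u r α) q = ev q (D j (u α)) := fun j => rfl
    simp only [characteristic, Fin.sum_univ_three, h, h0, h1, h2, hd]
    simp only [← ev_apply]
    fin_cases α <;> simp [hu, state, char, D_add, D_sub, D_mul, D_C, D_coord, ev_C] <;> ring
  have hK : ∀ α I, (prolong X (toMap u) p).2 α I =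
      ev p (DList I (![char ξ φ ψ, char ξ M V, char ξ S R] α)) +
      (ev p (ξ 0) * ev p (D 0 (DList I (u α))) + ev p (ξ 1) * ev p (D 1 (DList I (u α)))
        + ev p (ξ 2) * ev p (D 2 (DList I (u α)))) := by
    intro α I
    have h1 := (pdList_congr (hQ α) I).eq_of_nhds
    rw [pdList_coe] at h1
    have hd : ∀ j, pdList (j :: I) (fun q => toMap u q α) p = ev p (D j (DList I (u α))) :=
      fun j => congrFun (pdList_coe (j :: I) (u α)) p
    have h2 : ∀ j, (X (p, toMap u p)).1 j = ev p (ξ j) := fun j => (hξ j).eq_of_nhds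
    simp only [prolong, Fin.sum_univ_three, h1, hd, h2, ev_apply]
  rw [deriv_system]
  fin_cases k <;> simp only [hJ, hK] <;>
  simp [DList, hu, state, eqn, linEqn, lap, jac, D_add, D_sub, D_mul, D_C, D_coord, ev_C,
    D_comm10, D_comm20, D_comm21] <;>
  (try field_simp) <;> ring

/-- The frame dual to the coordinates `(t, x, z, ψ, v + f x, ρ - (N²/g) z)`. -/
noncomputable def frame (f g N : ℝ) : Fin 6 → Total :=
  ![(Pi.single 0 1, 0), (Pi.single 1 1, Pi.single 1 (-f)), (Pi.single 2 1, Pi.single 2 (N ^ 2 / g)),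
    (0, Pi.single 0 1), (0, Pi.single 1 1), (0, Pi.single 2 1)]

/-! ### The chain rule in the adapted frame. -/

section Chain

variable (f g N : ℝ)

/-- Along a graph, ∂_i moves the point by the i-th frame vector plus ψ_i, V_i, R_i times the last
three. The tilt of the frame compensates for v = V - f x and ρ = R + (N²/g) z. -/
theorem ev_D_subst (ψ V R : Smooth Base) (i : Fin 3) (F : Smooth Total) :
    D i (subst (state f g N ψ V R) F) =
      subst (state f g N ψ V R) (dir (frame f g N (Fin.castLE (by norm_num) i)) F)
      + D i ψ * subst (state f g N ψ V R) (dir (frame f g N 3) F)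
      + D i V * subst (state f g N ψ V R) (dir (frame f g N 4) F)
      + D i R * subst (state f g N ψ V R) (dir (frame f g N 5) F) := by
  refine Smooth.ext_ev fun p => ?_
  set u := state f g N ψ V R with hu
  have hd : fderiv ℝ (fun q : Base => ((q, toMap u q) : Total)) p (Pi.single i 1) =
      (Pi.single i 1, fun α => ev p (D i (u α))) := by
    have h1 : HasFDerivAt (toMap u)
        (ContinuousLinearMap.pi fun α => fderiv ℝ (u α).1 p) p :=
      hasFDerivAt_pi.2 fun α => (Smooth.differentiable (u α) p).hasFDerivAt
    have h2 := (hasFDerivAt_id p).prodMk h1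
    have h3 := congrArg (fun T : Base →L[ℝ] Total => T (Pi.single i 1)) h2.fderiv
    exact h3
  have key : ((Pi.single i 1, fun α => ev p (D i (u α))) : Total) =
      frame f g N (Fin.castLE (by norm_num) i) + ev p (D i ψ) • frame f g N 3
        + ev p (D i V) • frame f g N 4 + ev p (D i R) • frame f g N 5 := by
    refine Prod.ext ?_ ?_
    · fin_cases i <;> simp [frame]
    · funext α
      fin_cases i <;> fin_cases α <;>
        simp [frame, hu, state, D_add, D_sub, D_mul, D_C, D_coord, ev_C] <;> ring
  rw [D, subst, ev_dir_pullback, hd, key]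
  simp only [map_add, map_mul, map_smul, smul_eq_mul]
  rfl

end Chain

/-- The coordinate functions on the space of `(t, x, z)`, centred at a point. -/
noncomputable def centred (p : Base) (i : Fin 3) : Smooth Base := coord i - C (p i)

theorem ev_centred (p : Base) (i : Fin 3) : ev p (centred p i) = 0 := by
  simp [centred, ev_coord, ev_C]

theorem D_centred (p : Base) (i j : Fin 3) : D i (centred p j) = C (if i = j then 1 else 0) := by
  simp [centred, D_sub, D_coord, D_C]

theorem C_one : C 1 = 1 := map_one _
theorem C_zero : C 0 = 0 := map_zero _

/-- The infinitesimal invariance criterion for a vector field with components `T`, `Φ`, `M`, `S`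
on exact solutions whose graph passes through the point `m`. -/
def Criterion (f g N : ℝ) (T : Fin 3 → Smooth Total) (Φ M S : Smooth Total) (m : Total) : Prop :=
  ∀ ψ V R : Smooth Base, (∀ k, eqn f g ψ V R k = 0) →
    (m.1, toMap (state f g N ψ V R) m.1) = m → ∀ k,
    ev m.1 (linEqn f g ψ V R
      (char (fun j => subst (state f g N ψ V R) (T j)) (subst (state f g N ψ V R) Φ) ψ)
      (char (fun j => subst (state f g N ψ V R) (T j)) (subst (state f g N ψ V R) M) V)
      (char (fun j => subst (state f g N ψ V R) (T j)) (subst (state f g N ψ V R) S) R) k) = 0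

theorem state_eq (f g N : ℝ) (m : Total) {ψ V R : Smooth Base} (hψ : ev m.1 ψ = m.2 0)
    (hV : ev m.1 V = m.2 1 + f * m.1 1) (hR : ev m.1 R = m.2 2 - N ^ 2 / g * m.1 2) :
    (m.1, toMap (state f g N ψ V R) m.1) = m := by
  refine Prod.ext rfl (funext fun α => ?_)
  change ev m.1 (state f g N ψ V R α) = _
  fin_cases α <;> simp [state, hψ, hV, hR, ev_coord, ev_C]

theorem ev_subst_state {f g N : ℝ} {m : Total} {ψ V R : Smooth Base}
    (h : (m.1, toMap (state f g N ψ V R) m.1) = m) (F : Smooth Total) :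
    ev m.1 (subst (state f g N ψ V R) F) = ev m F := by rw [ev_subst, h]

/-! ### Determining equations from affine solutions. -/

section DeterminingEquations

variable {f g N : ℝ} {T : Fin 3 → Smooth Total} {Φ M S : Smooth Total} {m : Total}

theorem D0_subst (ψ V R : Smooth Base) (F : Smooth Total) :
    D 0 (subst (state f g N ψ V R) F) =
      subst (state f g N ψ V R) (dir (frame f g N 0) F)
      + D 0 ψ * subst (state f g N ψ V R) (dir (frame f g N 3) F)
      + D 0 V * subst (state f g N ψ V R) (dir (frame f g N 4) F)
      + D 0 R * subst (state f g N ψ V R) (dir (frame f g N 5) F) := ev_D_subst f g N ψ V R 0 F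
theorem D1_subst (ψ V R : Smooth Base) (F : Smooth Total) :
    D 1 (subst (state f g N ψ V R) F) =
      subst (state f g N ψ V R) (dir (frame f g N 1) F)
      + D 1 ψ * subst (state f g N ψ V R) (dir (frame f g N 3) F)
      + D 1 V * subst (state f g N ψ V R) (dir (frame f g N 4) F)
      + D 1 R * subst (state f g N ψ V R) (dir (frame f g N 5) F) := ev_D_subst f g N ψ V R 1 F
theorem D2_subst (ψ V R : Smooth Base) (F : Smooth Total) :
    D 2 (subst (state f g N ψ V R) F) =
      subst (state f g N ψ V R) (dir (frame f g N 2) F)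
      + D 2 ψ * subst (state f g N ψ V R) (dir (frame f g N 3) F)
      + D 2 V * subst (state f g N ψ V R) (dir (frame f g N 4) F)
      + D 2 R * subst (state f g N ψ V R) (dir (frame f g N 5) F) := ev_D_subst f g N ψ V R 2 F

theorem C_mul (a b : ℝ) : C (a * b) = C a * C b := map_mul _ _ _

/-- Test solutions with ψ affine in t, x, z, while V depends on x - b t and R on z + a t. Here ψ_x =
a and ψ_z = b, so V and R are transported, and V_z = R_x = Δψ = 0 solves the vorticity equation. The
two conclusions are the linearized transport equations, polynomial identities in the free
parameters. -/
theorem Criterion.affine_eqs (h : Criterion f g N T Φ M S m) (r a b k n : ℝ) :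
    (ev m (dir (frame f g N 0) M) + b * ev m (dir (frame f g N 1) M)
      - a * ev m (dir (frame f g N 2) M) + r * ev m (dir (frame f g N 3) M)
      + k * (b * (ev m (dir (frame f g N 0) (T 0)) + b * ev m (dir (frame f g N 1) (T 0))
            - a * ev m (dir (frame f g N 2) (T 0)) + r * ev m (dir (frame f g N 3) (T 0)))
        - (ev m (dir (frame f g N 0) (T 1)) + b * ev m (dir (frame f g N 1) (T 1))
            - a * ev m (dir (frame f g N 2) (T 1)) + r * ev m (dir (frame f g N 3) (T 1)))
        + (ev m (dir (frame f g N 2) Φ) + b * ev m (dir (frame f g N 3) Φ)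
            + n * ev m (dir (frame f g N 5) Φ))
        - r * (ev m (dir (frame f g N 2) (T 0)) + b * ev m (dir (frame f g N 3) (T 0))
            + n * ev m (dir (frame f g N 5) (T 0)))
        - a * (ev m (dir (frame f g N 2) (T 1)) + b * ev m (dir (frame f g N 3) (T 1))
            + n * ev m (dir (frame f g N 5) (T 1)))
        - b * (ev m (dir (frame f g N 2) (T 2)) + b * ev m (dir (frame f g N 3) (T 2))
            + n * ev m (dir (frame f g N 5) (T 2)))) = 0) ∧
    (ev m (dir (frame f g N 0) S) + b * ev m (dir (frame f g N 1) S)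
      - a * ev m (dir (frame f g N 2) S) + r * ev m (dir (frame f g N 3) S)
      - n * (a * (ev m (dir (frame f g N 0) (T 0)) + b * ev m (dir (frame f g N 1) (T 0))
            - a * ev m (dir (frame f g N 2) (T 0)) + r * ev m (dir (frame f g N 3) (T 0)))
        + (ev m (dir (frame f g N 0) (T 2)) + b * ev m (dir (frame f g N 1) (T 2))
            - a * ev m (dir (frame f g N 2) (T 2)) + r * ev m (dir (frame f g N 3) (T 2)))
        + (ev m (dir (frame f g N 1) Φ) + a * ev m (dir (frame f g N 3) Φ)
            + k * ev m (dir (frame f g N 4) Φ))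
        - r * (ev m (dir (frame f g N 1) (T 0)) + a * ev m (dir (frame f g N 3) (T 0))
            + k * ev m (dir (frame f g N 4) (T 0)))
        - a * (ev m (dir (frame f g N 1) (T 1)) + a * ev m (dir (frame f g N 3) (T 1))
            + k * ev m (dir (frame f g N 4) (T 1)))
        - b * (ev m (dir (frame f g N 1) (T 2)) + a * ev m (dir (frame f g N 3) (T 2))
            + k * ev m (dir (frame f g N 4) (T 2)))) = 0) := by
  set y := centred m.1 with hy
  set ψ := C (m.2 0) + C r * y 0 + C a * y 1 + C b * y 2 with hψ
  set V := C (m.2 1 + f * m.1 1) + C k * (y 1 - C b * y 0) with hV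
  set R := C (m.2 2 - N ^ 2 / g * m.1 2) + C n * (y 2 + C a * y 0) with hR
  have hm := state_eq f g N m (ψ := ψ) (V := V) (R := R)
    (by simp [hψ, hy, ev_C, ev_centred]) (by simp [hV, hy, ev_C, ev_centred])
    (by simp [hR, hy, ev_C, ev_centred])
  have hDψ : D 0 ψ = C r ∧ D 1 ψ = C a ∧ D 2 ψ = C b := by
    simp [hψ, hy, D_add, D_mul, D_C, D_centred, C_zero, C_one]
  have hDV : D 0 V = - C (k * b) ∧ D 1 V = C k ∧ D 2 V = 0 := by
    simp [hV, hy, D_add, D_sub, D_mul, D_C, D_centred, C_zero, C_one, C_mul]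
    ring
  have hDR : D 0 R = C (n * a) ∧ D 1 R = 0 ∧ D 2 R = C n := by
    simp [hR, hy, D_add, D_mul, D_C, D_centred, C_zero, C_one, C_mul]
  have h0 := h ψ V R (fun k => by
    fin_cases k <;> simp [eqn, lap, jac, hDψ, hDV, hDR, D_C, D_zero, C_mul] <;> ring) hm
  have h1 := h0 1
  have h2 := h0 2
  clear_value ψ V R
  simp [linEqn, char, jac, D_add, D_sub, D_neg, D_mul, D_C, D0_subst, D1_subst, D2_subst,
    hDψ, hDV, hDR, ev_subst_state hm, ev_C] at h1 h2
  constructor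
  · linear_combination h1
  · linear_combination h2

end DeterminingEquations

theorem D_one (i : Fin 3) : D i 1 = 0 := dir_one _

theorem C_two : C 2 = 2 := map_ofNat _ 2

theorem Smooth.ev_dir_of_eventually {E : Type*} [NormedAddCommGroup E] [NormedSpace ℝ E]
    {w : Smooth E} {m : E} (h : ∀ᶠ q in nhds m, ev q w = 0) (e : E) :
    ∀ᶠ q in nhds m, ev q (dir e w) = 0 := by
  have h' : w.1 =ᶠ[nhds m] fun _ => 0 := h
  filter_upwards [h'.fderiv (𝕜 := ℝ)] with q hq
  rw [ev_dir, hq]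
  simp

/-! ### Determining equations from harmonic, shear and rest solutions. -/

section DeterminingEquations

variable {f g N : ℝ} {T : Fin 3 → Smooth Total} {Φ M S : Smooth Total} {m : Total}

/-- Any ψ harmonic in (x, z) solves the system together with constant V and R. If moreover its
spatial gradient vanishes at the point, every Jacobian drops out of the linearized vorticity
equation there, leaving the time derivative of the Laplacian of one characteristic. -/
theorem Criterion.harmonic (h : Criterion f g N T Φ M S m) (ψ : Smooth Base)
    (hψ : ev m.1 ψ = m.2 0) (hlap : lap ψ = 0) (h1 : ev m.1 (D 1 ψ) = 0)
    (h2 : ev m.1 (D 2 ψ) = 0) :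
    ∃ V R : Smooth Base, (∀ i, D i V = 0) ∧ (∀ i, D i R = 0) ∧
      (m.1, toMap (state f g N ψ V R) m.1) = m ∧
      ev m.1 (D 0 (lap (char (fun j => subst (state f g N ψ V R) (T j))
        (subst (state f g N ψ V R) Φ) ψ)))
      - g * ev m (dir (frame f g N 1) S) - f * ev m (dir (frame f g N 2) M) = 0 := by
  set V := C (m.2 1 + f * m.1 1) with hV
  set R := C (m.2 2 - N ^ 2 / g * m.1 2) with hR
  have hm := state_eq f g N m (ψ := ψ) (V := V) (R := R) hψ (by simp [hV, ev_C])
    (by simp [hR, ev_C])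
  have hV' : ∀ i, D i V = 0 := fun i => D_C _ _
  have hR' : ∀ i, D i R = 0 := fun i => D_C _ _
  have h0 := h ψ V R (fun k => by
    fin_cases k <;> simp [eqn, hlap, jac, hV', hR', D_zero]) hm 0
  clear_value V R
  refine ⟨V, R, hV', hR', hm, ?_⟩
  simp only [linEqn, Matrix.cons_val_zero, jac, hlap, D_zero, mul_zero, sub_zero, map_sub,
    map_mul, h1, h2, zero_mul, ev_C] at h0
  rw [← h0]
  simp [char, D1_subst, D2_subst, hV', hR', h1, h2, ev_subst_state hm]

-- With ψ = a t²x + b t²z, the term T⁰ψ_t in the characteristic survives only through ψ_tt,x and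
-- ψ_tt,z. This isolates the spatial derivatives of T⁰.
set_option maxHeartbeats 1000000 in
theorem Criterion.harmonic_time_sq (h : Criterion f g N T Φ M S m) (a b : ℝ) :
    ev m (dir (frame f g N 0) (dir (frame f g N 1) (dir (frame f g N 1) Φ)))
      + ev m (dir (frame f g N 0) (dir (frame f g N 2) (dir (frame f g N 2) Φ)))
      - 4 * a * ev m (dir (frame f g N 1) (T 0)) - 4 * b * ev m (dir (frame f g N 2) (T 0))
      - g * ev m (dir (frame f g N 1) S) - f * ev m (dir (frame f g N 2) M) = 0 := by
  set y := centred m.1 with hy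
  set ψ := C (m.2 0) + C a * (y 0 * y 0 * y 1) + C b * (y 0 * y 0 * y 2) with hψ
  have hD0 : D 0 ψ = C 2 * (C a * (y 0 * y 1) + C b * (y 0 * y 2)) := by
    simp [hψ, hy, D_add, D_mul, D_C, D_centred, C_zero, C_one, C_two]; ring
  have hD1 : D 1 ψ = C a * (y 0 * y 0) := by
    simp [hψ, hy, D_add, D_mul, D_C, D_centred, C_zero, C_one]
  have hD2 : D 2 ψ = C b * (y 0 * y 0) := by
    simp [hψ, hy, D_add, D_mul, D_C, D_centred, C_zero, C_one]
  obtain ⟨V, R, hV', hR', hm, h0⟩ := h.harmonic ψ (by simp [hψ, hy, ev_C, ev_centred])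
    (by simp [lap, hD1, hD2, hy, D_mul, D_C, D_centred, C_zero])
    (by simp [hD1, hy, ev_centred]) (by simp [hD2, hy, ev_centred])
  clear_value ψ
  simp [char, lap, D_add, D_sub, D_neg, D_mul, D_C, D0_subst, D1_subst, D2_subst, D_one, D_zero,
    hD0, hD1, hD2, hV', hR', ev_subst_state hm, ev_C, D_centred, hy, ev_centred, C_zero,
    C_one] at h0
  linear_combination h0

-- With ψ = a t x, the part quadratic in a isolates the dependence of T⁰ on ψ.
set_option maxHeartbeats 1000000 in
theorem Criterion.harmonic_linear (h : Criterion f g N T Φ M S m) (a : ℝ) :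
    ev m (dir (frame f g N 0) (dir (frame f g N 1) (dir (frame f g N 1) Φ)))
      + ev m (dir (frame f g N 0) (dir (frame f g N 2) (dir (frame f g N 2) Φ)))
      + a * (ev m (dir (frame f g N 3) (dir (frame f g N 1) Φ))
        + ev m (dir (frame f g N 1) (dir (frame f g N 3) Φ))
        - 2 * ev m (dir (frame f g N 0) (dir (frame f g N 1) (T 0)))
        - ev m (dir (frame f g N 1) (dir (frame f g N 1) (T 1)))
        - ev m (dir (frame f g N 2) (dir (frame f g N 2) (T 1))))
      - 2 * a ^ 2 * ev m (dir (frame f g N 3) (T 0))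
      - g * ev m (dir (frame f g N 1) S) - f * ev m (dir (frame f g N 2) M) = 0 := by
  set y := centred m.1 with hy
  set ψ := C (m.2 0) + C a * (y 0 * y 1) with hψ
  have hD0 : D 0 ψ = C a * y 1 := by
    simp [hψ, hy, D_add, D_mul, D_C, D_centred, C_zero, C_one]
  have hD1 : D 1 ψ = C a * y 0 := by
    simp [hψ, hy, D_add, D_mul, D_C, D_centred, C_zero, C_one]
  have hD2 : D 2 ψ = 0 := by
    simp [hψ, hy, D_add, D_mul, D_C, D_centred, C_zero]
  obtain ⟨V, R, hV', hR', hm, h0⟩ := h.harmonic ψ (by simp [hψ, hy, ev_C, ev_centred])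
    (by simp [lap, hD1, hD2, hy, D_mul, D_C, D_centred, C_zero, D_zero])
    (by simp [hD1, hy, ev_centred]) (by simp [hD2])
  clear_value ψ
  simp [char, lap, D_add, D_sub, D_neg, D_mul, D_C, D0_subst, D1_subst, D2_subst, D_one, D_zero,
    hD0, hD1, hD2, hV', hR', ev_subst_state hm, ev_C, D_centred, hy, ev_centred, C_zero,
    C_one] at h0
  linear_combination h0

-- With the two quadratic harmonic polynomials multiplied by t, the coefficients of a and b are the
-- Cauchy–Riemann equations for (T¹, T²).
set_option maxHeartbeats 1000000 in
theorem Criterion.harmonic_quadratic (h : Criterion f g N T Φ M S m) (a b : ℝ) :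
    ev m (dir (frame f g N 0) (dir (frame f g N 1) (dir (frame f g N 1) Φ)))
      + ev m (dir (frame f g N 0) (dir (frame f g N 2) (dir (frame f g N 2) Φ)))
      - 4 * b * (ev m (dir (frame f g N 1) (T 1)) - ev m (dir (frame f g N 2) (T 2)))
      - 2 * a * (ev m (dir (frame f g N 1) (T 2)) + ev m (dir (frame f g N 2) (T 1)))
      - g * ev m (dir (frame f g N 1) S) - f * ev m (dir (frame f g N 2) M) = 0 := by
  set y := centred m.1 with hy
  set ψ := C (m.2 0) + C a * (y 0 * y 1 * y 2) + C b * (y 0 * (y 1 * y 1 - y 2 * y 2)) with hψ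
  have hD0 : D 0 ψ = C a * (y 1 * y 2) + C b * (y 1 * y 1 - y 2 * y 2) := by
    simp [hψ, hy, D_add, D_sub, D_mul, D_C, D_centred, C_zero, C_one]
  have hD1 : D 1 ψ = C a * (y 0 * y 2) + C b * (C 2 * (y 0 * y 1)) := by
    simp [hψ, hy, D_add, D_sub, D_mul, D_C, D_centred, C_zero, C_one, C_two]; ring
  have hD2 : D 2 ψ = C a * (y 0 * y 1) - C b * (C 2 * (y 0 * y 2)) := by
    simp [hψ, hy, D_add, D_sub, D_mul, D_C, D_centred, C_zero, C_one, C_two]; ring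
  obtain ⟨V, R, hV', hR', hm, h0⟩ := h.harmonic ψ (by simp [hψ, hy, ev_C, ev_centred])
    (by simp [lap, hD1, hD2, hy, D_add, D_sub, D_mul, D_C, D_centred, C_zero, C_one])
    (by simp [hD1, hy, ev_centred]) (by simp [hD2, hy, ev_centred])
  clear_value ψ
  simp [char, lap, D_add, D_sub, D_neg, D_mul, D_C, D0_subst, D1_subst, D2_subst, D_one, D_zero,
    hD0, hD1, hD2, hV', hR', ev_subst_state hm, ev_C, D_centred, hy, ev_centred, C_zero,
    C_one] at h0
  linear_combination h0

-- A vertical shear flow ψ = (r + g k t) x² accelerated by the buoyancy gradient R_x = 2k. The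
-- hypotheses near m remove the terms in which R_x multiplies derivatives of Φ and T¹ along R.
set_option maxHeartbeats 1000000 in
theorem Criterion.buoyancy_x (h : Criterion f g N T Φ M S m) (r k : ℝ)
    (hΦ : ∀ᶠ q in nhds m, ev q (dir (frame f g N 5) Φ) = 0)
    (hT : ∀ᶠ q in nhds m, ev q (dir (frame f g N 5) (T 1)) = 0) :
    ev m (dir (frame f g N 0) (dir (frame f g N 1) (dir (frame f g N 1) Φ)))
      + ev m (dir (frame f g N 0) (dir (frame f g N 2) (dir (frame f g N 2) Φ)))
      + 2 * r * (ev m (dir (frame f g N 0) (dir (frame f g N 3) Φ))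
        - 2 * ev m (dir (frame f g N 0) (dir (frame f g N 1) (T 1))))
      + 2 * k * g * (ev m (dir (frame f g N 3) Φ) - ev m (dir (frame f g N 0) (T 0))
        - ev m (dir (frame f g N 1) (T 1)) - ev m (dir (frame f g N 5) S))
      - g * ev m (dir (frame f g N 1) S) - f * ev m (dir (frame f g N 2) M) = 0 := by
  set y := centred m.1 with hy
  set ψ := C (m.2 0) + C r * (y 1 * y 1) + C (g * k) * (y 0 * y 1 * y 1) with hψ
  set V := C (m.2 1 + f * m.1 1) with hV
  set R := C (m.2 2 - N ^ 2 / g * m.1 2) + C 2 * C k * y 1 with hR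
  have hm := state_eq f g N m (ψ := ψ) (V := V) (R := R)
    (by simp [hψ, hy, ev_C, ev_centred]) (by simp [hV, ev_C])
    (by simp [hR, hy, ev_C, ev_centred])
  have hD0 : D 0 ψ = C (g * k) * (y 1 * y 1) := by
    simp [hψ, hy, D_add, D_mul, D_C, D_centred, C_zero, C_one]
  have hD1 : D 1 ψ = C 2 * C r * y 1 + C 2 * C (g * k) * (y 0 * y 1) := by
    simp [hψ, hy, D_add, D_mul, D_C, D_centred, C_zero, C_one, C_two]; ring
  have hD2 : D 2 ψ = 0 := by
    simp [hψ, hy, D_add, D_mul, D_C, D_centred, C_zero]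
  have hV' : ∀ i, D i V = 0 := fun i => D_C _ _
  have hR0 : D 0 R = 0 := by
    simp [hR, hy, D_add, D_mul, D_C, D_centred, C_zero]
  have hR1 : D 1 R = C 2 * C k := by
    simp [hR, hy, D_add, D_mul, D_C, D_centred, C_one]
  have hR2 : D 2 R = 0 := by
    simp [hR, hy, D_add, D_mul, D_C, D_centred, C_zero]
  have hlap : lap ψ = C 2 * C r + C 2 * C (g * k) * y 0 := by
    simp [lap, hD1, hD2, hy, D_add, D_mul, D_C, D_centred, C_zero, C_one, D_zero]
  have h0 := h ψ V R (fun k => by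
    fin_cases k <;> simp [eqn, hlap, jac, hV', hD2, hR2, hR0, hR1, D_add, D_mul, D_C, hy,
      D_centred, C_zero, C_one, C_mul]; ring) hm 0
  clear_value ψ V R
  -- Derivatives along R are moved innermost, where the vanishing near m applies.
  have c1 : dir (frame f g N 5) (dir (frame f g N 1) Φ)
    = dir (frame f g N 1) (dir (frame f g N 5) Φ) := dir_comm _ _ _
  have z1 := (Smooth.ev_dir_of_eventually (Smooth.ev_dir_of_eventually hΦ (frame f g N 1))
    (frame f g N 0)).self_of_nhds
  have z2 := (Smooth.ev_dir_of_eventually (Smooth.ev_dir_of_eventually hΦ (frame f g N 5))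
    (frame f g N 0)).self_of_nhds
  have z3 := (Smooth.ev_dir_of_eventually hT (frame f g N 0)).self_of_nhds
  have z4 := hT.self_of_nhds
  simp [linEqn, char, jac, hlap, D_add, D_mul, D_C, hy, D_centred, C_zero, C_one, C_mul] at h0
  simp [lap, D_add, D_sub, D_neg, D_mul, D_C, D0_subst, D1_subst, D2_subst, D_one,
    hD0, hD1, hD2, hV', hR0, hR1, hR2, D_zero, ev_subst_state hm, ev_C, D_centred, hy, ev_centred,
    C_zero, C_one, C_mul, c1, z1, z2, z3, z4] at h0
  linear_combination h0

-- The counterpart with V_z = 2k accelerating a horizontal shear flow ψ = f k t z². The conclusion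
-- carries the factor f because V forces the flow only through f.
set_option maxHeartbeats 1000000 in
theorem Criterion.buoyancy_z (h : Criterion f g N T Φ M S m) (k : ℝ)
    (hΦ : ∀ᶠ q in nhds m, ev q (dir (frame f g N 4) Φ) = 0)
    (hT : ∀ᶠ q in nhds m, ev q (dir (frame f g N 4) (T 2)) = 0) :
    ev m (dir (frame f g N 0) (dir (frame f g N 1) (dir (frame f g N 1) Φ)))
      + ev m (dir (frame f g N 0) (dir (frame f g N 2) (dir (frame f g N 2) Φ)))
      + 2 * k * f * (ev m (dir (frame f g N 3) Φ) - ev m (dir (frame f g N 0) (T 0))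
        - ev m (dir (frame f g N 2) (T 2)) - ev m (dir (frame f g N 4) M))
      - g * ev m (dir (frame f g N 1) S) - f * ev m (dir (frame f g N 2) M) = 0 := by
  set y := centred m.1 with hy
  set ψ := C (m.2 0) + C (f * k) * (y 0 * y 2 * y 2) with hψ
  set V := C (m.2 1 + f * m.1 1) + C 2 * C k * y 2 with hV
  set R := C (m.2 2 - N ^ 2 / g * m.1 2) with hR
  have hm := state_eq f g N m (ψ := ψ) (V := V) (R := R)
    (by simp [hψ, hy, ev_C, ev_centred]) (by simp [hV, hy, ev_C, ev_centred])
    (by simp [hR, ev_C])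
  have hD0 : D 0 ψ = C (f * k) * (y 2 * y 2) := by
    simp [hψ, hy, D_add, D_mul, D_C, D_centred, C_zero, C_one]
  have hD2 : D 2 ψ = C 2 * C (f * k) * (y 0 * y 2) := by
    simp [hψ, hy, D_add, D_mul, D_C, D_centred, C_zero, C_one, C_two]; ring
  have hD1 : D 1 ψ = 0 := by
    simp [hψ, hy, D_add, D_mul, D_C, D_centred, C_zero]
  have hR' : ∀ i, D i R = 0 := fun i => D_C _ _
  have hV0 : D 0 V = 0 := by
    simp [hV, hy, D_add, D_mul, D_C, D_centred, C_zero]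
  have hV2 : D 2 V = C 2 * C k := by
    simp [hV, hy, D_add, D_mul, D_C, D_centred, C_one]
  have hV1 : D 1 V = 0 := by
    simp [hV, hy, D_add, D_mul, D_C, D_centred, C_zero]
  have hlap : lap ψ = C 2 * C (f * k) * y 0 := by
    simp [lap, hD1, hD2, hy, D_add, D_mul, D_C, D_centred, C_zero, C_one, D_zero]
  have h0 := h ψ V R (fun k => by
    fin_cases k <;> simp [eqn, hlap, jac, hR', hD1, hV2, hV0, hV1, D_add, D_mul, D_C, hy,
      D_centred, C_zero, C_one, C_mul]; ring) hm 0
  clear_value ψ V R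
  have c1 : dir (frame f g N 4) (dir (frame f g N 2) Φ)
    = dir (frame f g N 2) (dir (frame f g N 4) Φ) := dir_comm _ _ _
  have z1 := (Smooth.ev_dir_of_eventually (Smooth.ev_dir_of_eventually hΦ (frame f g N 2))
    (frame f g N 0)).self_of_nhds
  have z2 := (Smooth.ev_dir_of_eventually (Smooth.ev_dir_of_eventually hΦ (frame f g N 4))
    (frame f g N 0)).self_of_nhds
  have z3 := (Smooth.ev_dir_of_eventually hT (frame f g N 0)).self_of_nhds
  have z4 := hT.self_of_nhds
  simp [linEqn, char, jac, hlap, D_add, D_mul, D_C, hy, D_centred, C_zero, C_one, C_mul] at h0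
  simp [lap, D_add, D_sub, D_neg, D_mul, D_C, D0_subst, D1_subst, D2_subst, D_one,
    hD0, hD1, hD2, hR', hV0, hV1, hV2, D_zero, ev_subst_state hm, ev_C, D_centred, hy, ev_centred,
    C_zero, C_one, C_mul, c1, z1, z2, z3, z4] at h0
  linear_combination h0

-- A state of rest with V = k x and R = n z. The coefficients of k and n couple the rotation terms
-- of T¹, T² to the mixing of V and R by M and S.
set_option maxHeartbeats 1000000 in
theorem Criterion.stationary (h : Criterion f g N T Φ M S m) (k n : ℝ)
    (hΦ4 : ∀ᶠ q in nhds m, ev q (dir (frame f g N 4) Φ) = 0)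
    (hΦ5 : ∀ᶠ q in nhds m, ev q (dir (frame f g N 5) Φ) = 0) :
    ev m (dir (frame f g N 0) (dir (frame f g N 1) (dir (frame f g N 1) Φ)))
      + ev m (dir (frame f g N 0) (dir (frame f g N 2) (dir (frame f g N 2) Φ)))
      - g * (ev m (dir (frame f g N 1) S) + k * ev m (dir (frame f g N 4) S)
        - (ev m (dir (frame f g N 1) (T 2)) + k * ev m (dir (frame f g N 4) (T 2))) * n)
      - f * (ev m (dir (frame f g N 2) M) + n * ev m (dir (frame f g N 5) M)
        - (ev m (dir (frame f g N 2) (T 1)) + n * ev m (dir (frame f g N 5) (T 1))) * k) = 0 := by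
  set y := centred m.1 with hy
  set ψ := C (m.2 0) with hψ
  set V := C (m.2 1 + f * m.1 1) + C k * y 1 with hV
  set R := C (m.2 2 - N ^ 2 / g * m.1 2) + C n * y 2 with hR
  have hm := state_eq f g N m (ψ := ψ) (V := V) (R := R)
    (by simp [hψ, ev_C]) (by simp [hV, hy, ev_centred, ev_C])
    (by simp [hR, hy, ev_C, ev_centred])
  have hψ' : ∀ i, D i ψ = 0 := fun i => D_C _ _
  have hR' : D 0 R = 0 ∧ D 1 R = 0 ∧ D 2 R = C n := by
    simp [hR, hy, D_add, D_mul, D_C, D_centred, C_zero, C_one]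
  have hV' : D 0 V = 0 ∧ D 1 V = C k ∧ D 2 V = 0 := by
    simp [hV, hy, D_add, D_mul, D_C, D_centred, C_zero, C_one]
  have h0 := h ψ V R (fun k => by
    fin_cases k <;> simp [eqn, lap, jac, hV', hR', hψ', D_zero]) hm 0
  clear_value ψ V R
  have c1 : dir (frame f g N 4) (dir (frame f g N 1) Φ)
    = dir (frame f g N 1) (dir (frame f g N 4) Φ) := dir_comm _ _ _
  have c2 : dir (frame f g N 5) (dir (frame f g N 2) Φ)
    = dir (frame f g N 2) (dir (frame f g N 5) Φ) := dir_comm _ _ _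
  have z1 := (Smooth.ev_dir_of_eventually (Smooth.ev_dir_of_eventually hΦ4 (frame f g N 1))
    (frame f g N 0)).self_of_nhds
  have z2 := (Smooth.ev_dir_of_eventually (Smooth.ev_dir_of_eventually hΦ4 (frame f g N 4))
    (frame f g N 0)).self_of_nhds
  have z3 := (Smooth.ev_dir_of_eventually (Smooth.ev_dir_of_eventually hΦ5 (frame f g N 2))
    (frame f g N 0)).self_of_nhds
  have z4 := (Smooth.ev_dir_of_eventually (Smooth.ev_dir_of_eventually hΦ5 (frame f g N 5))
    (frame f g N 0)).self_of_nhds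
  simp [linEqn, char, jac, lap, D_add, D_sub, D_neg, D_mul, D_C, D0_subst, D1_subst, D2_subst,
    hψ', hV', hR', D_zero, ev_subst_state hm, ev_C, c1, c2, z1, z2, z3, z4] at h0
  linear_combination h0

end DeterminingEquations

/-! ### Calculus along the frame on the open set U. -/

section Frame

variable (f g N : ℝ)

/-- The derivative along a field of the frame. -/
noncomputable def fr (i : Fin 6) (F : Total → ℝ) : Total → ℝ :=
  fun m => fderiv ℝ F m (frame f g N i)

variable {f g N} {U : Set Total} {F G : Total → ℝ} {m : Total}

theorem fr_eventuallyEq (h : F =ᶠ[nhds m] G) (i : Fin 6) : fr f g N i F =ᶠ[nhds m] fr f g N i G := by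
  filter_upwards [h.fderiv (𝕜 := ℝ)] with q hq
  simp only [fr, hq]

theorem fr_congr (hU : IsOpen U) (h : ∀ q ∈ U, F q = G q) (i : Fin 6) :
    ∀ q ∈ U, fr f g N i F q = fr f g N i G q := fun _ hq =>
  (fr_eventuallyEq (Filter.eventuallyEq_of_mem (hU.mem_nhds hq) h) i).eq_of_nhds

theorem fr_const (c : ℝ) (i : Fin 6) : fr f g N i (fun _ => c) m = 0 := by
  simp [fr]

theorem fr_add (hF : DifferentiableAt ℝ F m) (hG : DifferentiableAt ℝ G m) (i : Fin 6) :
    fr f g N i (fun q => F q + G q) m = fr f g N i F m + fr f g N i G m := by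
  simp only [fr]
  rw [fderiv_fun_add hF hG]; rfl

theorem fr_sub (hF : DifferentiableAt ℝ F m) (hG : DifferentiableAt ℝ G m) (i : Fin 6) :
    fr f g N i (fun q => F q - G q) m = fr f g N i F m - fr f g N i G m := by
  simp only [fr]
  rw [fderiv_fun_sub hF hG]; rfl

theorem fr_neg (i : Fin 6) : fr f g N i (fun q => -F q) m = -fr f g N i F m := by
  simp only [fr]
  rw [fderiv_fun_neg]; rfl

theorem fr_mul_const (hF : DifferentiableAt ℝ F m) (c : ℝ) (i : Fin 6) :
    fr f g N i (fun q => c * F q) m = c * fr f g N i F m := by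
  simp only [fr]
  rw [fderiv_const_mul hF]; rfl

theorem fr_clm (L : Total →L[ℝ] ℝ) (i : Fin 6) : fr f g N i L m = L (frame f g N i) := by
  simp [fr]

theorem contDiffOn_fr (hU : IsOpen U) (hF : ContDiffOn ℝ ∞ F U) (i : Fin 6) :
    ContDiffOn ℝ ∞ (fr f g N i F) U :=
  (hF.fderiv_of_isOpen hU (m := ∞) (by simp)).clm_apply contDiffOn_const

theorem differentiableAt_of_contDiffOn (hU : IsOpen U) (hF : ContDiffOn ℝ ∞ F U) (hm : m ∈ U) :
    DifferentiableAt ℝ F m :=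
  (hF.contDiffAt (hU.mem_nhds hm)).differentiableAt (by simp)

theorem fr_comm (hU : IsOpen U) (hF : ContDiffOn ℝ ∞ F U) (i j : Fin 6) (hm : m ∈ U) :
    fr f g N i (fr f g N j F) m = fr f g N j (fr f g N i F) m := by
  obtain ⟨G, hG, hFG⟩ := exists_contDiff_eventuallyEq hU hF hm
  have key : ∀ a b, fr f g N a (fr f g N b F) m =
      ev m (dir (frame f g N a) (dir (frame f g N b) ⟨G, hG⟩)) := fun a b =>
    (fr_eventuallyEq (fr_eventuallyEq hFG.symm b) a).eq_of_nhds
  rw [key, key, dir_comm]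

variable (f g N) in
theorem eq_sum_frame (w : Total) :
    w = w.1 0 • frame f g N 0 + w.1 1 • frame f g N 1 + w.1 2 • frame f g N 2
      + w.2 0 • frame f g N 3 + (w.2 1 + f * w.1 1) • frame f g N 4
      + (w.2 2 - N ^ 2 / g * w.1 2) • frame f g N 5 := by
  refine Prod.ext (funext fun j => ?_) (funext fun j => ?_) <;> fin_cases j <;>
    simp [frame] <;> ring

variable (f g N) in
theorem fderiv_eq_sum_fr (F : Total → ℝ) (m w : Total) :
    fderiv ℝ F m w = w.1 0 * fr f g N 0 F m + w.1 1 * fr f g N 1 F m + w.1 2 * fr f g N 2 F m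
      + w.2 0 * fr f g N 3 F m + (w.2 1 + f * w.1 1) * fr f g N 4 F m
      + (w.2 2 - N ^ 2 / g * w.1 2) * fr f g N 5 F m := by
  conv_lhs => rw [eq_sum_frame f g N w]
  simp only [map_add, map_smul, smul_eq_mul, fr]

theorem exists_const_of_fr (hU : IsOpen U) (hUc : Convex ℝ U) (hF : ContDiffOn ℝ ∞ F U)
    (h : ∀ i, ∀ m ∈ U, fr f g N i F m = 0) : ∃ c, ∀ m ∈ U, F m = c := by
  refine hU.exists_is_const_of_fderiv_eq_zero hUc.isPreconnected
    (hF.differentiableOn (by simp)) fun m hm => ?_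
  ext w <;> simp [fderiv_eq_sum_fr f g N F m, h _ m hm]

end Frame

/-- A smooth function on an open convex set whose derivative vanishes on the kernel of a linear
map with a right inverse is a smooth function of that map. -/
theorem exists_contDiffOn_factor {E F : Type*} [NormedAddCommGroup E] [NormedSpace ℝ E]
    [NormedAddCommGroup F] [NormedSpace ℝ F] {U : Set E} (hU : IsOpen U) (hUc : Convex ℝ U)
    {G : E → ℝ} (hG : ContDiffOn ℝ ∞ G U) (L : E →L[ℝ] F) (s : F →L[ℝ] E)
    (hs : ∀ y, L (s y) = y) (h : ∀ m ∈ U, ∀ w, L w = 0 → fderiv ℝ G m w = 0) :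
    ∃ H : F → ℝ, ContDiffOn ℝ ∞ H (L '' U) ∧ ∀ m ∈ U, G m = H (L m) := by
  -- Two points of U in one fibre are joined by a segment inside U whose direction lies in the
  -- kernel of L, so G is constant along it.
  have hconst : ∀ m ∈ U, ∀ m' ∈ U, L m = L m' → G m = G m' := by
    intro m hm m' hm' hL
    have hseg : ∀ t ∈ Set.Icc (0 : ℝ) 1, AffineMap.lineMap m m' t ∈ U := fun t ht =>
      hUc.lineMap_mem hm hm' ht
    have hd : ∀ t ∈ Set.Icc (0 : ℝ) 1,
        HasDerivWithinAt (fun t : ℝ => G (AffineMap.lineMap m m' t)) 0 (Set.Icc 0 1) t := by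
      intro t ht
      have h1 : HasFDerivAt G (fderiv ℝ G (AffineMap.lineMap m m' t)) (AffineMap.lineMap m m' t) :=
        ((hG.contDiffAt (hU.mem_nhds (hseg t ht))).differentiableAt (by simp)).hasFDerivAt
      have h2 := h1.comp_hasDerivAt t (AffineMap.hasDerivAt_lineMap (a := m) (b := m') (x := t))
      rw [h _ (hseg t ht) _ (by rw [map_sub, hL, sub_self])] at h2
      exact h2.hasDerivWithinAt
    have := constant_of_derivWithin_zero (f := fun t : ℝ => G (AffineMap.lineMap m m' t))
      (a := 0) (b := 1) (fun t ht => (hd t ht).differentiableWithinAt)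
      (fun t ht => (hd t (Set.Ico_subset_Icc_self ht)).derivWithin
        (uniqueDiffOn_Icc one_pos t (Set.Ico_subset_Icc_self ht))) 1 (by simp)
    simpa using this.symm
  classical
  let H : F → ℝ := fun y => if hy : ∃ m ∈ U, L m = y then G hy.choose else 0
  have hH : ∀ m ∈ U, G m = H (L m) := by
    intro m hm
    have hy : ∃ m' ∈ U, L m' = L m := ⟨m, hm, rfl⟩
    simp only [H, dif_pos hy]
    exact hconst _ hm _ hy.choose_spec.1 hy.choose_spec.2.symm
  refine ⟨H, ?_, hH⟩
  rintro _ ⟨m, hm, rfl⟩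
  -- The affine section y ↦ m + s (y - L m) passes through m, so near L m the function H is G
  -- composed with it.
  have hc : ContDiff ℝ ∞ fun y : F => m + s (y - L m) :=
    contDiff_const.add (s.contDiff.comp (contDiff_id.sub contDiff_const))
  have hc0 : m + s (L m - L m) = m := by simp
  have hnear : ∀ᶠ y in nhds (L m), m + s (y - L m) ∈ U :=
    hc.continuous.continuousAt.eventually_mem (by rw [hc0]; exact hU.mem_nhds hm)
  have h1 : ContDiffAt ℝ ∞ (fun y : F => G (m + s (y - L m))) (L m) :=
    ContDiffAt.comp (L m) (g := G) (by rw [hc0]; exact hG.contDiffAt (hU.mem_nhds hm))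
      hc.contDiffAt
  refine (h1.congr_of_eventuallyEq ?_).contDiffWithinAt
  filter_upwards [hnear] with y hy
  rw [hH _ hy]
  simp [hs]

/-- The fields `ξ`, `φ`, `μ + f ξ¹`, `σ - (N²/g) ξ²` of an admitted vector field agree near a point
with smooth functions satisfying the criterion. -/
theorem IsAdmitted.exists_criterion {f g N : ℝ} (hg : g ≠ 0) {U : Set Total} (hU : IsOpen U)
    {X : Total → Total} (hX : ContDiffOn ℝ ∞ X U) (hA : IsAdmitted f g N U X) {m : Total}
    (hm : m ∈ U) :
    ∃ (T : Fin 3 → Smooth Total) (Φ M S : Smooth Total), Criterion f g N T Φ M S m ∧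
      (∀ j, (fun q => (X q).1 j) =ᶠ[nhds m] (T j).1) ∧
      (fun q => (X q).2 0) =ᶠ[nhds m] Φ.1 ∧
      (fun q => (X q).2 1 + f * (X q).1 1) =ᶠ[nhds m] M.1 ∧
      (fun q => (X q).2 2 - N ^ 2 / g * (X q).1 2) =ᶠ[nhds m] S.1 := by
  obtain ⟨Y, hY, hXY⟩ := exists_contDiff_eventuallyEq hU hX hm
  have h1 : ∀ j, ContDiff ℝ ∞ fun q => (Y q).1 j := fun j =>
    contDiff_pi.1 (contDiff_fst.comp hY) j
  have h2 : ∀ j, ContDiff ℝ ∞ fun q => (Y q).2 j := fun j =>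
    contDiff_pi.1 (contDiff_snd.comp hY) j
  have h3 : ContDiff ℝ ∞ fun q => (Y q).2 1 + f * (Y q).1 1 :=
    (h2 1).add (contDiff_const.mul (h1 1))
  have h4 : ContDiff ℝ ∞ fun q => (Y q).2 2 - N ^ 2 / g * (Y q).1 2 :=
    (h2 2).sub (contDiff_const.mul (h1 2))
  refine ⟨fun j => ⟨_, h1 j⟩, ⟨_, h2 0⟩, ⟨_, h3⟩, ⟨_, h4⟩, ?_, ?_, ?_, ?_, ?_⟩
  · intro ψ V R hE hp k
    have hadm := hA (toMap (state f g N ψ V R)) (contDiff_toMap _) m.1 (by rwa [hp])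
      (solvesAt_of_eqn hg m.1 hE) k
    have hnear : ∀ᶠ q in nhds m.1, Y (q, toMap (state f g N ψ V R) q)
        = X (q, toMap (state f g N ψ V R) q) := by
      have hc : ContinuousAt (fun q : Base => ((q, toMap (state f g N ψ V R) q) : Total)) m.1 :=
        (contDiff_graph _).continuous.continuousAt
      have : Filter.Tendsto (fun q : Base => ((q, toMap (state f g N ψ V R) q) : Total))
        (nhds m.1) (nhds m) := by
        have h := hc.tendsto
        rwa [hp] at h
      exact this.eventually hXY
    -- The total-derivative terms of this formula vanish because the equations hold identically
    -- along the test solution.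
    rw [deriv_system_prolong f g N hg X ψ V R m.1
      (fun j => subst (state f g N ψ V R) ⟨_, h1 j⟩) (subst (state f g N ψ V R) ⟨_, h2 0⟩)
      (subst (state f g N ψ V R) ⟨_, h3⟩)
      (subst (state f g N ψ V R) ⟨_, h4⟩)] at hadm
    · simpa [hE, D_zero] using hadm
    · intro j
      filter_upwards [hnear] with q hq
      rw [← hq]; rfl
    · intro α
      filter_upwards [hnear] with q hq
      rw [← hq, ← ev_apply]
      fin_cases α <;> simp [ev_C, ev_subst] <;> simp [ev_apply]
  · intro j; filter_upwards [hXY] with q hq; rw [← hq]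
  · filter_upwards [hXY] with q hq; rw [← hq]
  · filter_upwards [hXY] with q hq; rw [← hq]
  · filter_upwards [hXY] with q hq; rw [← hq]

/-- The first-order determining equations that follow from the transport equations, for functions
`T`, `Φ`, `M`, `S` on `U`. -/
structure TransportEqs (f g N : ℝ) (U : Set Total) (T : Fin 3 → Total → ℝ) (Φ M S : Total → ℝ) :
    Prop where
  M_lt : ∀ m ∈ U, fr f g N 0 M m = 0 ∧ fr f g N 1 M m = 0 ∧ fr f g N 2 M m = 0 ∧ fr f g N 3 M m = 0
  S_lt : ∀ m ∈ U, fr f g N 0 S m = 0 ∧ fr f g N 1 S m = 0 ∧ fr f g N 2 S m = 0 ∧ fr f g N 3 S m = 0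
  T4 : ∀ j, ∀ m ∈ U, fr f g N 4 (T j) m = 0
  T5 : ∀ j, ∀ m ∈ U, fr f g N 5 (T j) m = 0
  Φ4 : ∀ m ∈ U, fr f g N 4 Φ m = 0
  Φ5 : ∀ m ∈ U, fr f g N 5 Φ m = 0
  T03 : ∀ m ∈ U, fr f g N 3 (T 0) m = 0
  T01 : ∀ m ∈ U, fr f g N 1 (T 0) m = 0
  T02 : ∀ m ∈ U, fr f g N 2 (T 0) m = 0
  T13 : ∀ m ∈ U, fr f g N 3 (T 1) m = 0
  T23 : ∀ m ∈ U, fr f g N 3 (T 2) m = 0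
  Φ1 : ∀ m ∈ U, fr f g N 1 Φ m = -fr f g N 0 (T 2) m
  Φ2 : ∀ m ∈ U, fr f g N 2 Φ m = fr f g N 0 (T 1) m
  Φ3 : ∀ m ∈ U, fr f g N 3 Φ m = 2 * fr f g N 1 (T 1) m - fr f g N 0 (T 0) m
  T22 : ∀ m ∈ U, fr f g N 2 (T 2) m = fr f g N 1 (T 1) m
  T21 : ∀ m ∈ U, fr f g N 1 (T 2) m = -fr f g N 2 (T 1) m

/-- The remaining determining equations. -/
structure VorticityEqs (f g N : ℝ) (U : Set Total) (T : Fin 3 → Total → ℝ) (Φ M S : Total → ℝ) :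
    Prop where
  Φ03 : ∀ m ∈ U, fr f g N 0 (fr f g N 3 Φ) m = 2 * fr f g N 0 (fr f g N 1 (T 1)) m
  S5 : ∀ m ∈ U, fr f g N 5 S m = fr f g N 1 (T 1) m - 2 * fr f g N 0 (T 0) m
  M4 : ∀ m ∈ U, f * fr f g N 4 M m = f * (fr f g N 1 (T 1) m - 2 * fr f g N 0 (T 0) m)
  S4 : ∀ m ∈ U, g * fr f g N 4 S m = f * fr f g N 2 (T 1) m
  M5 : ∀ m ∈ U, f * fr f g N 5 M m = -(g * fr f g N 2 (T 1) m)

/-! ### Extraction of the determining equations. -/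

section Equations

variable {f g N : ℝ} {U : Set Total} {X : Total → Total}

theorem ev_dir_frame {F : Total → ℝ} {F' : Smooth Total} {m : Total} (h : F =ᶠ[nhds m] F'.1)
    (i : Fin 6) : ev m (dir (frame f g N i) F') = fr f g N i F m :=
  (fr_eventuallyEq h.symm i).eq_of_nhds

theorem ev_dir_dir_frame {F : Total → ℝ} {F' : Smooth Total} {m : Total} (h : F =ᶠ[nhds m] F'.1)
    (i j : Fin 6) : ev m (dir (frame f g N i) (dir (frame f g N j) F'))
      = fr f g N i (fr f g N j F) m :=
  (fr_eventuallyEq (fr_eventuallyEq h.symm j) i).eq_of_nhds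

theorem eventually_ev_dir_frame {F : Total → ℝ} {F' : Smooth Total} {m : Total}
    (h : F =ᶠ[nhds m] F'.1) (hU : IsOpen U) (hm : m ∈ U) (i : Fin 6)
    (h0 : ∀ q ∈ U, fr f g N i F q = 0) : ∀ᶠ q in nhds m, ev q (dir (frame f g N i) F') = 0 := by
  filter_upwards [fr_eventuallyEq h.symm i, hU.mem_nhds hm] with q hq hqU
  exact Eq.trans hq (h0 q hqU)

theorem IsAdmitted.transportEqs (hg : g ≠ 0) (hU : IsOpen U) (hX : ContDiffOn ℝ ∞ X U)
    (hA : IsAdmitted f g N U X) :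
    TransportEqs f g N U (fun j q => (X q).1 j) (fun q => (X q).2 0)
      (fun q => (X q).2 1 + f * (X q).1 1) (fun q => (X q).2 2 - N ^ 2 / g * (X q).1 2) := by
  set T : Fin 3 → Total → ℝ := fun j q => (X q).1 j with hTdef
  set Φ : Total → ℝ := fun q => (X q).2 0 with hΦdef
  set M : Total → ℝ := fun q => (X q).2 1 + f * (X q).1 1 with hMdef
  set S : Total → ℝ := fun q => (X q).2 2 - N ^ 2 / g * (X q).1 2 with hSdef
  have key : ∀ m ∈ U,
      (fr f g N 0 M m = 0 ∧ fr f g N 1 M m = 0 ∧ fr f g N 2 M m = 0 ∧ fr f g N 3 M m = 0) ∧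
      (fr f g N 0 S m = 0 ∧ fr f g N 1 S m = 0 ∧ fr f g N 2 S m = 0 ∧ fr f g N 3 S m = 0) ∧
      (∀ j, fr f g N 4 (T j) m = 0) ∧ (∀ j, fr f g N 5 (T j) m = 0) ∧
      fr f g N 4 Φ m = 0 ∧ fr f g N 5 Φ m = 0 ∧
      fr f g N 3 (T 0) m = 0 ∧ fr f g N 1 (T 0) m = 0 ∧ fr f g N 2 (T 0) m = 0 ∧
      fr f g N 3 (T 1) m = 0 ∧ fr f g N 3 (T 2) m = 0 ∧
      fr f g N 1 Φ m = -fr f g N 0 (T 2) m ∧ fr f g N 2 Φ m = fr f g N 0 (T 1) m ∧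
      fr f g N 3 Φ m = 2 * fr f g N 1 (T 1) m - fr f g N 0 (T 0) m ∧
      fr f g N 2 (T 2) m = fr f g N 1 (T 1) m ∧ fr f g N 1 (T 2) m = -fr f g N 2 (T 1) m := by
    intro m hm
    obtain ⟨T', Φ', M', S', hC, hT, hΦ, hM, hS⟩ := hA.exists_criterion hg hU hX hm
    have dT : ∀ i j, ev m (dir (frame f g N i) (T' j)) = fr f g N i (T j) m := fun i j =>
      ev_dir_frame (hT j) i
    have dΦ : ∀ i, ev m (dir (frame f g N i) Φ') = fr f g N i Φ m := ev_dir_frame hΦ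
    have dM : ∀ i, ev m (dir (frame f g N i) M') = fr f g N i M m := ev_dir_frame hM
    have dS : ∀ i, ev m (dir (frame f g N i) S') = fr f g N i S m := ev_dir_frame hS
    have e := hC.affine_eqs
    have q₁ := hC.harmonic_time_sq
    have q₂ := hC.harmonic_linear
    have q₃ := hC.harmonic_quadratic
    simp only [dT, dΦ, dM, dS] at e q₁ q₂ q₃
    have e₁ := fun r a b k n => (e r a b k n).1
    have e₂ := fun r a b k n => (e r a b k n).2
    clear e
    -- The identities hold for all parameter values; evaluating them at a few values and taking
    -- differences isolates single coefficients. Those with k = 0 or n = 0 show that M and S have no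
    -- derivatives along the first four frame directions.
    have M0 : fr f g N 0 M m = 0 := by linarith [e₁ 0 0 0 0 0]
    have M1 : fr f g N 1 M m = 0 := by linarith [e₁ 0 0 1 0 0]
    have M2 : fr f g N 2 M m = 0 := by linarith [e₁ 0 1 0 0 0]
    have M3 : fr f g N 3 M m = 0 := by linarith [e₁ 1 0 0 0 0]
    have S0 : fr f g N 0 S m = 0 := by linarith [e₂ 0 0 0 0 0]
    have S1 : fr f g N 1 S m = 0 := by linarith [e₂ 0 0 1 0 0]
    have S2 : fr f g N 2 S m = 0 := by linarith [e₂ 0 1 0 0 0]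
    have S3 : fr f g N 3 S m = 0 := by linarith [e₂ 1 0 0 0 0]
    simp only [M0, M1, M2, M3, S0, S1, S2, S3, mul_zero, sub_zero, add_zero, zero_add,
      zero_sub] at e₁ e₂ q₁ q₂ q₃
    -- The terms in k n are the derivatives along R in the first identity and along V in the second;
    -- those of Φ come first, then those of T.
    have Φ5 : fr f g N 5 Φ m = 0 := by linarith [e₁ 0 0 0 1 1, e₁ 0 0 0 1 0]
    have T05 : fr f g N 5 (T 0) m = 0 := by linarith [e₁ 1 0 0 1 1, e₁ 1 0 0 1 0]
    have T15 : fr f g N 5 (T 1) m = 0 := by linarith [e₁ 0 1 0 1 1, e₁ 0 1 0 1 0]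
    have T25 : fr f g N 5 (T 2) m = 0 := by linarith [e₁ 0 0 1 1 1, e₁ 0 0 1 1 0]
    have Φ4 : fr f g N 4 Φ m = 0 := by linarith [e₂ 0 0 0 1 1, e₂ 0 0 0 0 1]
    have T04 : fr f g N 4 (T 0) m = 0 := by linarith [e₂ 1 0 0 1 1, e₂ 1 0 0 0 1]
    have T14 : fr f g N 4 (T 1) m = 0 := by linarith [e₂ 0 1 0 1 1, e₂ 0 1 0 0 1]
    have T24 : fr f g N 4 (T 2) m = 0 := by linarith [e₂ 0 0 1 1 1, e₂ 0 0 1 0 1]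
    have T01 : fr f g N 1 (T 0) m = 0 := by linarith [q₁ 1 0, q₁ 0 0]
    have T02 : fr f g N 2 (T 0) m = 0 := by linarith [q₁ 0 1, q₁ 0 0]
    have T03 : fr f g N 3 (T 0) m = 0 := by linarith [q₂ 1, q₂ (-1), q₂ 0]
    have T22 : fr f g N 2 (T 2) m = fr f g N 1 (T 1) m := by linarith [q₃ 0 1, q₃ 0 0]
    have T21 : fr f g N 1 (T 2) m = -fr f g N 2 (T 1) m := by linarith [q₃ 1 0, q₃ 0 0]
    have Φ2 : fr f g N 2 Φ m = fr f g N 0 (T 1) m := by linarith [e₁ 0 0 0 1 0]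
    have Φ1 : fr f g N 1 Φ m = -fr f g N 0 (T 2) m := by linarith [e₂ 0 0 0 0 1]
    have T13 : fr f g N 3 (T 1) m = 0 := by linarith [e₁ 1 0 0 1 0]
    have T23 : fr f g N 3 (T 2) m = 0 := by linarith [e₂ 1 0 0 0 1]
    have Φ3 : fr f g N 3 Φ m = 2 * fr f g N 1 (T 1) m - fr f g N 0 (T 0) m := by
      linarith [e₁ 0 0 1 1 0]
    refine ⟨⟨M0, M1, M2, M3⟩, ⟨S0, S1, S2, S3⟩, fun j => ?_, fun j => ?_, Φ4, Φ5, T03, T01, T02,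
      T13, T23, Φ1, Φ2, Φ3, T22, T21⟩
    · fin_cases j
      exacts [T04, T14, T24]
    · fin_cases j
      exacts [T05, T15, T25]
  clear_value T Φ M S
  exact
    { M_lt := fun m hm => (key m hm).1
      S_lt := fun m hm => (key m hm).2.1
      T4 := fun j m hm => (key m hm).2.2.1 j
      T5 := fun j m hm => (key m hm).2.2.2.1 j
      Φ4 := fun m hm => by simp [key m hm]
      Φ5 := fun m hm => by simp [key m hm]
      T03 := fun m hm => by simp [key m hm]
      T01 := fun m hm => by simp [key m hm]
      T02 := fun m hm => by simp [key m hm]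
      T13 := fun m hm => by simp [key m hm]
      T23 := fun m hm => by simp [key m hm]
      Φ1 := fun m hm => by simp [key m hm]
      Φ2 := fun m hm => by simp [key m hm]
      Φ3 := fun m hm => by simp [key m hm]
      T22 := fun m hm => by simp [key m hm]
      T21 := fun m hm => by simp [key m hm] }

theorem IsAdmitted.vorticityEqs (hg : g ≠ 0) (hU : IsOpen U) (hX : ContDiffOn ℝ ∞ X U)
    (hA : IsAdmitted f g N U X) :
    VorticityEqs f g N U (fun j q => (X q).1 j) (fun q => (X q).2 0)
      (fun q => (X q).2 1 + f * (X q).1 1) (fun q => (X q).2 2 - N ^ 2 / g * (X q).1 2) := by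
  have t := hA.transportEqs hg hU hX
  set T : Fin 3 → Total → ℝ := fun j q => (X q).1 j with hTdef
  set Φ : Total → ℝ := fun q => (X q).2 0 with hΦdef
  set M : Total → ℝ := fun q => (X q).2 1 + f * (X q).1 1 with hMdef
  set S : Total → ℝ := fun q => (X q).2 2 - N ^ 2 / g * (X q).1 2 with hSdef
  have key : ∀ m ∈ U,
      fr f g N 0 (fr f g N 3 Φ) m = 2 * fr f g N 0 (fr f g N 1 (T 1)) m ∧
      fr f g N 5 S m = fr f g N 1 (T 1) m - 2 * fr f g N 0 (T 0) m ∧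
      f * fr f g N 4 M m = f * (fr f g N 1 (T 1) m - 2 * fr f g N 0 (T 0) m) ∧
      g * fr f g N 4 S m = f * fr f g N 2 (T 1) m ∧
      f * fr f g N 5 M m = -(g * fr f g N 2 (T 1) m) := by
    intro m hm
    obtain ⟨T', Φ', M', S', hC, hT, hΦ, hM, hS⟩ := hA.exists_criterion hg hU hX hm
    have dT : ∀ i j, ev m (dir (frame f g N i) (T' j)) = fr f g N i (T j) m := fun i j =>
      ev_dir_frame (hT j) i
    have dΦ : ∀ i, ev m (dir (frame f g N i) Φ') = fr f g N i Φ m := ev_dir_frame hΦ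
    have dM : ∀ i, ev m (dir (frame f g N i) M') = fr f g N i M m := ev_dir_frame hM
    have dS : ∀ i, ev m (dir (frame f g N i) S') = fr f g N i S m := ev_dir_frame hS
    have hΦ4 := eventually_ev_dir_frame (f := f) (g := g) (N := N) hΦ hU hm 4 t.Φ4
    have hΦ5 := eventually_ev_dir_frame (f := f) (g := g) (N := N) hΦ hU hm 5 t.Φ5
    have q₁ := fun r k => hC.buoyancy_x r k hΦ5 (eventually_ev_dir_frame (hT 1) hU hm 5 (t.T5 1))
    have q₂ := fun k => hC.buoyancy_z k hΦ4 (eventually_ev_dir_frame (hT 2) hU hm 4 (t.T4 2))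
    have q₃ := fun k n => hC.stationary k n hΦ4 hΦ5
    simp only [dT, dΦ, dM, dS, ev_dir_dir_frame hΦ, ev_dir_dir_frame (hT 1)] at q₁ q₂ q₃
    simp only [(t.S_lt m hm).2.1, (t.M_lt m hm).2.2.1, t.Φ3 m hm, t.T22 m hm, t.T21 m hm,
      t.T5 _ m hm, t.T4 _ m hm] at q₁ q₂ q₃
    refine ⟨by linarith [q₁ 1 0, q₁ 0 0], ?_, by linarith [q₂ 1, q₂ 0],
      by linarith [q₃ 1 0, q₃ 0 0], by linarith [q₃ 0 1, q₃ 0 0]⟩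
    have : g * (fr f g N 5 S m - (fr f g N 1 (T 1) m - 2 * fr f g N 0 (T 0) m)) = 0 := by
      linarith [q₁ 0 1, q₁ 0 0]
    linarith [(mul_eq_zero.1 this).resolve_left hg]
  exact ⟨fun m hm => (key m hm).1, fun m hm => (key m hm).2.1, fun m hm => (key m hm).2.2.1,
    fun m hm => (key m hm).2.2.2.1, fun m hm => (key m hm).2.2.2.2⟩

end Equations

/-- The coordinates of the base as linear functionals on the space of all variables. -/
noncomputable def baseCoord (j : Fin 3) : Total →L[ℝ] ℝ :=
  (ContinuousLinearMap.proj j).comp (ContinuousLinearMap.fst ℝ Base Fibre)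

/-- The coordinates of the fibre as linear functionals on the space of all variables. -/
noncomputable def fibreCoord (j : Fin 3) : Total →L[ℝ] ℝ :=
  (ContinuousLinearMap.proj j).comp (ContinuousLinearMap.snd ℝ Base Fibre)

theorem baseCoord_apply (j : Fin 3) (m : Total) : baseCoord j m = m.1 j := rfl
theorem fibreCoord_apply (j : Fin 3) (m : Total) : fibreCoord j m = m.2 j := rfl

/-- The materially conserved quantities `(v + f x, g ρ - N² z)`. -/
noncomputable def conserved (f g N : ℝ) : Total →L[ℝ] ℝ × ℝ :=
  (fibreCoord 1 + f • baseCoord 1).prod (g • fibreCoord 2 - N ^ 2 • baseCoord 2)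

theorem conserved_apply (f g N : ℝ) (m : Total) :
    conserved f g N m = (m.2 1 + f * m.1 1, g * m.2 2 - N ^ 2 * m.1 2) := rfl

/-- The normal form of an infinitesimal symmetry. -/
noncomputable def normalField (f g N : ℝ) (U : Set Total) (τ₀ τ₁ α κ s₀ : ℝ) (a b c : ℝ → ℝ)
    (H : ℝ × ℝ → ℝ) : Total → Total :=
  field U fun t x z ψ v ρ =>
    (![τ₀ + τ₁ * t, (α + 2 * τ₁) * x + κ * z + b t, (α + 2 * τ₁) * z - κ * x + c t],
      ![(2 * α + 3 * τ₁) * ψ + deriv b t * z - deriv c t * x + a t,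
        H (v + f * x, g * ρ - N ^ 2 * z) - f * ((α + 2 * τ₁) * x + κ * z + b t),
        (α * (g * ρ - N ^ 2 * z) + f * κ * (v + f * x) + s₀) / g
          + N ^ 2 / g * ((α + 2 * τ₁) * z - κ * x + c t)])

/-- A vector field of normal form: the function `H` is affine if `f ≠ 0`, and there is no
rotation if `f = 0`. -/
def IsNormal (f g N : ℝ) (U : Set Total) (X : Total → Total) : Prop :=
  ∃ (τ₀ τ₁ α κ s₀ : ℝ) (a b c : ℝ → ℝ) (H : ℝ × ℝ → ℝ),
    TimeFunction U a ∧ TimeFunction U b ∧ TimeFunction U c ∧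
    ContDiffOn ℝ ∞ H (conserved f g N '' U) ∧
    (∀ y ∈ conserved f g N '' U, f * fderiv ℝ H y (1, 0) = f * α) ∧
    (∀ y ∈ conserved f g N '' U, f * fderiv ℝ H y (0, 1) = -κ) ∧
    X = normalField f g N U τ₀ τ₁ α κ s₀ a b c H

theorem isOpen_image_time {U : Set Total} (hU : IsOpen U) :
    IsOpen ((fun m : Total => m.1 0) '' U) :=
  ((isOpenMap_eval (X := fun _ : Fin 3 => ℝ) 0).comp isOpenMap_fst) U hU

theorem conserved_section {f g N : ℝ} (hg : g ≠ 0) :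
    ∃ s : ℝ × ℝ →L[ℝ] Total, ∀ y, conserved f g N (s y) = y := by
  refine ⟨(0 : ℝ × ℝ →L[ℝ] Base).prod (ContinuousLinearMap.pi
    ![0, ContinuousLinearMap.fst ℝ ℝ ℝ, (1 / g) • ContinuousLinearMap.snd ℝ ℝ ℝ]), fun y => ?_⟩
  refine Prod.ext ?_ ?_ <;> simp [conserved_apply]
  field_simp

theorem isOpen_image_conserved {f g N : ℝ} (hg : g ≠ 0) {U : Set Total} (hU : IsOpen U) :
    IsOpen (conserved f g N '' U) := by
  obtain ⟨s, hs⟩ := conserved_section (f := f) (N := N) hg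
  exact (conserved f g N).isOpenMap (fun y => ⟨s y, hs y⟩) U hU

/-! ### Integration of the determining equations to the normal form. -/

section Integration

variable {f g N : ℝ} {U : Set Total} {T : Fin 3 → Total → ℝ} {Φ M S : Total → ℝ}

/-- By the Cauchy–Riemann equations ∂_x T¹ is half the spatial divergence, and compatibility of the
derivatives of Φ makes it constant. The mixed derivative of Φ in x and z equals both ∂_t ∂_x T¹ and
its negative. Exchanging ∂_ψ with ∂_x or ∂_z handles the spatial directions. -/
theorem TransportEqs.fr_divergence (t : TransportEqs f g N U T Φ M S) (hU : IsOpen U)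
    (hT : ∀ j, ContDiffOn ℝ ∞ (T j) U) (hΦ : ContDiffOn ℝ ∞ Φ U) (i : Fin 6) :
    ∀ m ∈ U, fr f g N i (fr f g N 1 (T 1)) m = 0 := by
  intro m hm
  have dT : ∀ j k, DifferentiableAt ℝ (fr f g N k (T j)) m := fun j k =>
    differentiableAt_of_contDiffOn hU (contDiffOn_fr hU (hT j) k) hm
  have cT : ∀ j k l, fr f g N k (fr f g N l (T j)) m = fr f g N l (fr f g N k (T j)) m :=
    fun j k l => fr_comm hU (hT j) k l hm
  have cΦ : ∀ k l, fr f g N k (fr f g N l Φ) m = fr f g N l (fr f g N k Φ) m :=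
    fun k l => fr_comm hU hΦ k l hm
  have zero : ∀ {F : Total → ℝ}, (∀ q ∈ U, F q = 0) → ∀ k, fr f g N k F m = 0 := fun h k => by
    rw [fr_congr hU h k m hm, fr_const]
  have a3 : ∀ k, fr f g N k (fr f g N 3 Φ) m
      = 2 * fr f g N k (fr f g N 1 (T 1)) m - fr f g N k (fr f g N 0 (T 0)) m := fun k => by
    rw [fr_congr hU t.Φ3 k m hm, fr_sub ((dT 1 1).const_mul 2) (dT 0 0), fr_mul_const (dT 1 1)]
  have a2 : ∀ k, fr f g N k (fr f g N 2 Φ) m = fr f g N k (fr f g N 0 (T 1)) m := fun k =>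
    fr_congr hU t.Φ2 k m hm
  have a1 : ∀ k, fr f g N k (fr f g N 1 Φ) m = -fr f g N k (fr f g N 0 (T 2)) m := fun k => by
    rw [fr_congr hU t.Φ1 k m hm, fr_neg]
  fin_cases i
  · have h1 := a2 1
    have h2 := a1 2
    rw [cT 1 1 0] at h1
    rw [cΦ 2 1, h1, cT 2 2 0, fr_congr hU t.T22 0 m hm] at h2
    simp only [Fin.zero_eta]
    linarith
  · have h1 := a3 1
    rw [cΦ 1 3, a1 3, cT 2 3 0, zero t.T23, cT 0 1 0, zero t.T01] at h1
    simp only [Fin.mk_one]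
    linarith
  · have h1 := a3 2
    rw [cΦ 2 3, a2 3, cT 1 3 0, zero t.T13, cT 0 2 0, zero t.T02] at h1
    simp only [Fin.reduceFinMk]
    linarith
  · exact (cT 1 3 1).trans (zero t.T13 1)
  · exact (cT 1 4 1).trans (zero (t.T4 1) 1)
  · exact (cT 1 5 1).trans (zero (t.T5 1) 1)

/-- The only nontrivial direction is t: both `TransportEqs.Φ3` and `VorticityEqs.Φ03` evaluate ∂_t
∂_ψ Φ, and their difference is ∂_t² T⁰. -/
theorem TransportEqs.fr_time (t : TransportEqs f g N U T Φ M S)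
    (w : VorticityEqs f g N U T Φ M S) (hU : IsOpen U)
    (hT : ∀ j, ContDiffOn ℝ ∞ (T j) U) (i : Fin 6) :
    ∀ m ∈ U, fr f g N i (fr f g N 0 (T 0)) m = 0 := by
  intro m hm
  have dT : ∀ j k, DifferentiableAt ℝ (fr f g N k (T j)) m := fun j k =>
    differentiableAt_of_contDiffOn hU (contDiffOn_fr hU (hT j) k) hm
  have cT : ∀ j k l, fr f g N k (fr f g N l (T j)) m = fr f g N l (fr f g N k (T j)) m :=
    fun j k l => fr_comm hU (hT j) k l hm
  have zero : ∀ {F : Total → ℝ}, (∀ q ∈ U, F q = 0) → ∀ k, fr f g N k F m = 0 := fun h k => by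
    rw [fr_congr hU h k m hm, fr_const]
  fin_cases i
  · have h1 := w.Φ03 m hm
    rw [fr_congr hU t.Φ3 0 m hm, fr_sub ((dT 1 1).const_mul 2) (dT 0 0),
      fr_mul_const (dT 1 1)] at h1
    simp only [Fin.zero_eta]
    linarith
  · exact (cT 0 1 0).trans (zero t.T01 0)
  · exact (cT 0 2 0).trans (zero t.T02 0)
  · exact (cT 0 3 0).trans (zero t.T03 0)
  · exact (cT 0 4 0).trans (zero (t.T4 0) 0)
  · exact (cT 0 5 0).trans (zero (t.T5 0) 0)

/-- For the spatial directions this is the constancy of the divergence combined with the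
Cauchy–Riemann equations. In time it comes from `VorticityEqs.M5`, since M does not depend on t; g ≠
0 suffices, and f may vanish. -/
theorem TransportEqs.fr_rotation (t : TransportEqs f g N U T Φ M S)
    (w : VorticityEqs f g N U T Φ M S) (hg : g ≠ 0) (hU : IsOpen U)
    (hT : ∀ j, ContDiffOn ℝ ∞ (T j) U) (hΦ : ContDiffOn ℝ ∞ Φ U) (hM : ContDiffOn ℝ ∞ M U)
    (i : Fin 6) : ∀ m ∈ U, fr f g N i (fr f g N 2 (T 1)) m = 0 := by
  intro m hm
  have dT : ∀ j k, DifferentiableAt ℝ (fr f g N k (T j)) m := fun j k =>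
    differentiableAt_of_contDiffOn hU (contDiffOn_fr hU (hT j) k) hm
  have dM : ∀ k, DifferentiableAt ℝ (fr f g N k M) m := fun k =>
    differentiableAt_of_contDiffOn hU (contDiffOn_fr hU hM k) hm
  have cT : ∀ j k l, fr f g N k (fr f g N l (T j)) m = fr f g N l (fr f g N k (T j)) m :=
    fun j k l => fr_comm hU (hT j) k l hm
  have zero : ∀ {F : Total → ℝ}, (∀ q ∈ U, F q = 0) → ∀ k, fr f g N k F m = 0 := fun h k => by
    rw [fr_congr hU h k m hm, fr_const]
  fin_cases i
  · have h1 := fr_congr (f := f) (g := g) (N := N) hU w.M5 0 m hm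
    rw [fr_mul_const (dM 5), fr_neg, fr_mul_const (dT 1 2), fr_comm hU hM 0 5 hm,
      zero fun q hq => (t.M_lt q hq).1] at h1
    have h2 : g * fr f g N 0 (fr f g N 2 (T 1)) m = 0 := by linarith
    exact (mul_eq_zero.1 h2).resolve_left hg
  · exact (cT 1 1 2).trans (t.fr_divergence hU hT hΦ 2 m hm)
  · have h1 := fr_congr (f := f) (g := g) (N := N) hU t.T21 2 m hm
    rw [fr_neg, cT 2 2 1, fr_congr hU t.T22 1 m hm, t.fr_divergence hU hT hΦ 1 m hm] at h1
    simp only [Fin.reduceFinMk]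
    linarith
  · exact (cT 1 3 2).trans (zero t.T13 2)
  · exact (cT 1 4 2).trans (zero (t.T4 1) 2)
  · exact (cT 1 5 2).trans (zero (t.T5 1) 2)

theorem exists_timeFunction (hU : IsOpen U) (hUc : Convex ℝ U) {F : Total → ℝ}
    (hF : ContDiffOn ℝ ∞ F U) (h : ∀ i : Fin 6, i ≠ 0 → ∀ m ∈ U, fr f g N i F m = 0) :
    ∃ a, TimeFunction U a ∧ ∀ m ∈ U, F m = a (m.1 0) := by
  refine exists_contDiffOn_factor hU hUc hF (baseCoord 0)
    ((ContinuousLinearMap.pi ![ContinuousLinearMap.id ℝ ℝ, 0, 0]).prod 0) (fun y => ?_)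
    (fun m hm w hw => ?_)
  · simp [baseCoord_apply]
  · have hw' : w.1 0 = 0 := hw
    rw [fderiv_eq_sum_fr f g N F m w, hw', h 1 (by decide) m hm, h 2 (by decide) m hm,
      h 3 (by decide) m hm, h 4 (by decide) m hm, h 5 (by decide) m hm]
    ring

theorem TimeFunction.hasDerivAt {a : ℝ → ℝ} (ha : TimeFunction U a) (hU : IsOpen U) {m : Total}
    (hm : m ∈ U) : HasDerivAt a (deriv a (m.1 0)) (m.1 0) :=
  ((ha.contDiffAt ((isOpen_image_time hU).mem_nhds ⟨m, hm, rfl⟩)).differentiableAt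
    (by simp)).hasDerivAt

theorem TimeFunction.deriv {a : ℝ → ℝ} (ha : TimeFunction U a) (hU : IsOpen U) :
    TimeFunction U (deriv a) := by
  have := ContDiffOn.deriv_of_isOpen (m := ∞) ha (isOpen_image_time hU) (by simp)
  exact this

theorem TimeFunction.contDiffOn_comp {a : ℝ → ℝ} (ha : TimeFunction U a) :
    ContDiffOn ℝ ∞ (fun m : Total => a (m.1 0)) U :=
  ContDiffOn.comp ha (baseCoord 0).contDiff.contDiffOn fun m hm => ⟨m, hm, rfl⟩

theorem TimeFunction.fr_comp {a : ℝ → ℝ} (ha : TimeFunction U a) (hU : IsOpen U) {m : Total}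
    (hm : m ∈ U) (i : Fin 6) :
    fr f g N i (fun q => a (q.1 0)) m = _root_.deriv a (m.1 0) * (frame f g N i).1 0 := by
  have h1 := (ha.hasDerivAt hU hm).comp_hasFDerivAt (f := fun q : Total => q.1 0) m
    (baseCoord 0).hasFDerivAt
  have h2 := congrArg (fun L : Total →L[ℝ] ℝ => L (frame f g N i)) h1.fderiv
  exact h2

theorem fr_mul {F G : Total → ℝ} {m : Total} (hF : DifferentiableAt ℝ F m)
    (hG : DifferentiableAt ℝ G m) (i : Fin 6) :
    fr f g N i (fun q => F q * G q) m = F m * fr f g N i G m + fr f g N i F m * G m := by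
  simp only [fr]
  rw [fderiv_fun_mul hF hG]
  simp
  ring

/-- The derivative of a composition with the conserved quantities. -/
theorem fr_conserved (hg : g ≠ 0) (hU : IsOpen U) {H : ℝ × ℝ → ℝ}
    (hH : ContDiffOn ℝ ∞ H (conserved f g N '' U)) {m : Total} (hm : m ∈ U) (i : Fin 6) :
    fr f g N i (fun q => H (conserved f g N q)) m
      = fderiv ℝ H (conserved f g N m) (conserved f g N (frame f g N i)) := by
  have h1 : HasFDerivAt H (fderiv ℝ H (conserved f g N m)) (conserved f g N m) :=
    ((hH.contDiffAt ((isOpen_image_conserved hg hU).mem_nhds ⟨m, hm, rfl⟩)).differentiableAt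
      (by simp)).hasFDerivAt
  have h2 := h1.comp m (conserved f g N).hasFDerivAt
  exact congrArg (fun L : Total →L[ℝ] ℝ => L (frame f g N i)) h2.fderiv

theorem IsAdmitted.isNormal (hg : g ≠ 0) (hU : IsOpen U) (hUc : Convex ℝ U) {X : Total → Total}
    (hX : ContDiffOn ℝ ∞ X U) (hX0 : ∀ m, m ∉ U → X m = 0) (hA : IsAdmitted f g N U X) :
    IsNormal f g N U X := by
  have t := hA.transportEqs hg hU hX
  have w := hA.vorticityEqs hg hU hX
  have hT : ∀ j, ContDiffOn ℝ ∞ (fun q => (X q).1 j) U := fun j =>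
    contDiffOn_pi.1 (contDiff_fst.comp_contDiffOn hX) j
  have hE : ∀ j, ContDiffOn ℝ ∞ (fun q => (X q).2 j) U := fun j =>
    contDiffOn_pi.1 (contDiff_snd.comp_contDiffOn hX) j
  have hM : ContDiffOn ℝ ∞ (fun q => (X q).2 1 + f * (X q).1 1) U :=
    (hE 1).add (contDiffOn_const.mul (hT 1))
  have hS : ContDiffOn ℝ ∞ (fun q => (X q).2 2 - N ^ 2 / g * (X q).1 2) U :=
    (hE 2).sub (contDiffOn_const.mul (hT 2))
  have hΦ := hE 0
  -- These identities keep the link between X and its components, which are made opaque just below.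
  have vT : ∀ j m, (X m).1 j = (fun j q => (X q).1 j : Fin 3 → Total → ℝ) j m := fun _ _ => rfl
  have vΦ : ∀ m, (X m).2 0 = (fun q => (X q).2 0 : Total → ℝ) m := fun _ => rfl
  have vM : ∀ m, (X m).2 1 = (fun q => (X q).2 1 + f * (X q).1 1 : Total → ℝ) m
      - f * (fun j q => (X q).1 j : Fin 3 → Total → ℝ) 1 m := fun _ => by simp
  have vS : ∀ m, (X m).2 2 = (fun q => (X q).2 2 - N ^ 2 / g * (X q).1 2 : Total → ℝ) m
      + N ^ 2 / g * (fun j q => (X q).1 j : Fin 3 → Total → ℝ) 2 m := fun _ => by simp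
  generalize (fun j q => (X q).1 j : Fin 3 → Total → ℝ) = T at *
  generalize (fun q => (X q).2 0 : Total → ℝ) = Φ at *
  generalize (fun q => (X q).2 1 + f * (X q).1 1 : Total → ℝ) = M at *
  generalize (fun q => (X q).2 2 - N ^ 2 / g * (X q).1 2 : Total → ℝ) = S at *
  replace hT : ∀ j, ContDiffOn ℝ ∞ (T j) U := fun j => by simpa only [vT] using hT j
  have diff : ∀ {F : Total → ℝ}, ContDiffOn ℝ ∞ F U → ∀ m ∈ U, DifferentiableAt ℝ F m :=
    fun hF m hm => differentiableAt_of_contDiffOn hU hF hm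
  -- The three constants are the rates of time dilation, spatial dilation and rotation. Subtracting
  -- the linear fields they generate leaves a constant in T⁰ and functions of t in T¹, T² and Φ.
  obtain ⟨τ₁, hτ₁⟩ := exists_const_of_fr (f := f) (g := g) (N := N) hU hUc
    (contDiffOn_fr hU (hT 0) 0) (t.fr_time w hU hT)
  obtain ⟨l, hl⟩ := exists_const_of_fr (f := f) (g := g) (N := N) hU hUc
    (contDiffOn_fr hU (hT 1) 1) (t.fr_divergence hU hT hΦ)
  obtain ⟨κ, hκ⟩ := exists_const_of_fr (f := f) (g := g) (N := N) hU hUc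
    (contDiffOn_fr hU (hT 1) 2) (t.fr_rotation w hg hU hT hΦ hM)
  have sub_clm : ∀ {F : Total → ℝ}, ContDiffOn ℝ ∞ F U → ∀ (L : Total →L[ℝ] ℝ) (i : Fin 6),
      ∀ m ∈ U, fr f g N i (fun q => F q - L q) m = fr f g N i F m - L (frame f g N i) :=
    fun hF L i m hm => by rw [fr_sub (diff hF m hm) L.differentiableAt, fr_clm]
  obtain ⟨τ₀, hτ₀⟩ := exists_const_of_fr (f := f) (g := g) (N := N) hU hUc
    ((hT 0).sub (τ₁ • baseCoord 0).contDiff.contDiffOn) fun i m hm => by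
      rw [sub_clm (hT 0) _ i m hm]
      fin_cases i <;> simp [frame, baseCoord_apply, hτ₁ m hm, t.T01 m hm, t.T02 m hm, t.T03 m hm,
        t.T4 0 m hm, t.T5 0 m hm]
  obtain ⟨b, hb, hTb⟩ := exists_timeFunction (f := f) (g := g) (N := N) hU hUc
    ((hT 1).sub (l • baseCoord 1 + κ • baseCoord 2).contDiff.contDiffOn) fun i hi m hm => by
      rw [sub_clm (hT 1) _ i m hm]
      fin_cases i <;> simp [frame, baseCoord_apply, hl m hm, hκ m hm, t.T13 m hm,
        t.T4 1 m hm, t.T5 1 m hm] at hi ⊢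
  obtain ⟨c, hc, hTc⟩ := exists_timeFunction (f := f) (g := g) (N := N) hU hUc
    ((hT 2).sub (l • baseCoord 2 - κ • baseCoord 1).contDiff.contDiffOn) fun i hi m hm => by
      rw [sub_clm (hT 2) _ i m hm]
      fin_cases i <;> simp [frame, baseCoord_apply, hl m hm, hκ m hm, t.T21 m hm, t.T22 m hm,
        t.T23 m hm, t.T4 2 m hm, t.T5 2 m hm] at hi ⊢
  have hb' : ∀ m ∈ U, fr f g N 0 (T 1) m = deriv b (m.1 0) := fun m hm => by
    have h1 := fr_congr (f := f) (g := g) (N := N) hU hTb 0 m hm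
    rw [sub_clm (hT 1) _ 0 m hm, hb.fr_comp hU hm] at h1
    simpa [frame, baseCoord_apply] using h1
  have hc' : ∀ m ∈ U, fr f g N 0 (T 2) m = deriv c (m.1 0) := fun m hm => by
    have h1 := fr_congr (f := f) (g := g) (N := N) hU hTc 0 m hm
    rw [sub_clm (hT 2) _ 0 m hm, hc.fr_comp hU hm] at h1
    simpa [frame, baseCoord_apply] using h1
  have hbz := (hb.deriv hU).contDiffOn_comp.mul (baseCoord 2).contDiff.contDiffOn
  have hcx := (hc.deriv hU).contDiffOn_comp.mul (baseCoord 1).contDiff.contDiffOn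
  have hΦ' := hΦ.sub ((2 * l - τ₁) • fibreCoord 0).contDiff.contDiffOn
  have hΦb := hΦ'.sub hbz
  obtain ⟨a, ha, hΦa⟩ := exists_timeFunction (f := f) (g := g) (N := N) hU hUc
    (hΦb.add hcx) fun i hi m hm => by
      rw [fr_add (diff hΦb m hm) (diff hcx m hm),
        fr_sub (diff hΦ' m hm) (diff hbz m hm), sub_clm hΦ _ i m hm,
        fr_mul (diff (hb.deriv hU).contDiffOn_comp m hm) (baseCoord 2).differentiableAt,
        fr_mul (diff (hc.deriv hU).contDiffOn_comp m hm) (baseCoord 1).differentiableAt,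
        (hb.deriv hU).fr_comp hU hm, (hc.deriv hU).fr_comp hU hm, fr_clm, fr_clm]
      fin_cases i <;> simp [frame, baseCoord_apply, fibreCoord_apply, t.Φ1 m hm, t.Φ2 m hm,
        t.Φ3 m hm, t.Φ4 m hm, t.Φ5 m hm, hl m hm, hτ₁ m hm, hb' m hm, hc' m hm] at hi ⊢
  -- All derivatives of S are known constants, so S is affine in V and R. For M only the
  -- independence of t, x, z, ψ is used here, whence a function H of the conserved pair.
  obtain ⟨s₀, hs₀⟩ := exists_const_of_fr (f := f) (g := g) (N := N) hU hUc
    (hS.sub (((l - 2 * τ₁) / g) • (g • fibreCoord 2 - N ^ 2 • baseCoord 2)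
      + (f * κ / g) • (fibreCoord 1 + f • baseCoord 1)).contDiff.contDiffOn) fun i m hm => by
      rw [sub_clm hS _ i m hm]
      have h4 : fr f g N 4 S m = f * κ / g := by
        rw [eq_div_iff hg, mul_comm, w.S4 m hm, hκ m hm]
      have hN : g * (N ^ 2 / g) = N ^ 2 := mul_div_cancel₀ _ hg
      obtain ⟨h0, h1, h2, h3⟩ := t.S_lt m hm
      fin_cases i <;> simp [frame, baseCoord_apply, fibreCoord_apply, h0, h1, h2, h3, h4,
        w.S5 m hm, hl m hm, hτ₁ m hm, hN, hg]
  obtain ⟨s, hs⟩ := conserved_section (f := f) (N := N) hg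
  obtain ⟨H, hH, hMH⟩ := exists_contDiffOn_factor hU hUc hM (conserved f g N) s hs
    fun m hm q hq => by
      obtain ⟨h0, h1, h2, h3⟩ := t.M_lt m hm
      have hq1 : q.2 1 + f * q.1 1 = 0 := congrArg Prod.fst hq
      have hq2 : g * q.2 2 - N ^ 2 * q.1 2 = 0 := congrArg Prod.snd hq
      have hq3 : q.2 2 - N ^ 2 / g * q.1 2 = 0 := by field_simp; linarith
      rw [fderiv_eq_sum_fr f g N M m q, h0, h1, h2, h3, hq1, hq3]
      ring
  have hHfr : ∀ m ∈ U, ∀ i, fr f g N i M m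
      = fderiv ℝ H (conserved f g N m) (conserved f g N (frame f g N i)) := fun m hm i => by
    rw [fr_congr hU hMH i m hm, fr_conserved hg hU hH hm]
  -- The choice α = l - 2τ₁ is the derivative of S along R; it separates the pure space scaling from
  -- the scaling that involves time. The factor g offsets the division by g in the normal form.
  refine ⟨τ₀, τ₁, l - 2 * τ₁, κ, g * s₀, a, b, c, H, ha, hb, hc, hH, ?_, ?_, ?_⟩
  · rintro _ ⟨m, hm, rfl⟩
    have h1 := w.M4 m hm
    have h2 : conserved f g N (frame f g N 4) = (1, 0) := by simp [conserved_apply, frame]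
    rwa [hHfr m hm, h2, hl m hm, hτ₁ m hm] at h1
  · rintro _ ⟨m, hm, rfl⟩
    have h1 := w.M5 m hm
    have h2 : conserved f g N (frame f g N 5) = g • (0, 1) := by simp [conserved_apply, frame]
    rw [hHfr m hm, h2, map_smul, smul_eq_mul, hκ m hm] at h1
    exact mul_left_cancel₀ hg (by linarith)
  · funext m
    by_cases hm : m ∈ U
    · have e0 := hτ₀ m hm
      have e1 := hTb m hm
      have e2 := hTc m hm
      have e3 := hΦa m hm
      have e4 := hMH m hm
      have e5 := hs₀ m hm
      simp [baseCoord_apply, fibreCoord_apply] at e0 e1 e2 e3 e5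
      rw [normalField, field, Set.indicator_of_mem hm]
      have x0 : (X m).1 0 = τ₀ + τ₁ * m.1 0 := by rw [vT]; linarith
      have x1 : (X m).1 1 = (l - 2 * τ₁ + 2 * τ₁) * m.1 1 + κ * m.1 2 + b (m.1 0) := by
        rw [vT]; linarith
      have x2 : (X m).1 2 = (l - 2 * τ₁ + 2 * τ₁) * m.1 2 - κ * m.1 1 + c (m.1 0) := by
        rw [vT]; linarith
      refine Prod.ext (funext fun j => ?_) (funext fun j => ?_) <;> fin_cases j
      · simpa using x0
      · simpa using x1
      · simpa using x2
      · simp [vΦ]; linarith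
      · simp [vM, e4, ← vT, x1, conserved_apply]
      · simp [vS, ← vT, x2]
        have : S m = (l - 2 * τ₁) / g * (g * m.2 2 - N ^ 2 * m.1 2)
            + f * κ / g * (m.2 1 + f * m.1 1) + s₀ := by linarith
        rw [this]
        field_simp
    · rw [hX0 m hm, normalField, field, Set.indicator_of_notMem hm]

end Integration

theorem TimeFunction.exists_smooth {U : Set Total} (hU : IsOpen U) {a : ℝ → ℝ}
    (ha : TimeFunction U a) {m : Total} (hm : m ∈ U) :
    ∃ A : Smooth Base, D 1 A = 0 ∧ D 2 A = 0 ∧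
      ∀ᶠ q in nhds m.1, A.1 q = a (q 0) ∧ (D 0 A).1 q = _root_.deriv a (q 0) := by
  obtain ⟨α, hα, hαa⟩ := exists_contDiff_eventuallyEq (isOpen_image_time hU) ha ⟨m, hm, rfl⟩
  have hproj : ContDiff ℝ ∞ fun q : Base => q 0 := contDiff_apply ℝ ℝ 0
  have hD : ∀ i (q : Base), fderiv ℝ (fun q : Base => α (q 0)) q (Pi.single i 1)
      = _root_.deriv α (q 0) * (Pi.single i 1 : Base) 0 := by
    intro i q
    have h1 := ((hα.differentiable (by simp)) (q 0)).hasDerivAt.comp_hasFDerivAt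
      (f := fun q : Base => q 0) q
      (ContinuousLinearMap.proj (R := ℝ) (φ := fun _ : Fin 3 => ℝ) 0).hasFDerivAt
    exact congrArg (fun L : Base →L[ℝ] ℝ => L (Pi.single i 1)) h1.fderiv
  refine ⟨⟨fun q => α (q 0), hα.comp hproj⟩, ?_, ?_, ?_⟩
  · exact Smooth.ext_ev fun q => (hD 1 q).trans (by simp)
  · exact Smooth.ext_ev fun q => (hD 2 q).trans (by simp)
  · have ht : Filter.Tendsto (fun q : Base => q 0) (nhds m.1) (nhds (m.1 0)) :=
      hproj.continuous.continuousAt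
    filter_upwards [ht.eventually hαa, ht.eventually hαa.deriv] with q h1 h2
    exact ⟨h1, (hD 0 q).trans (by simp [h2])⟩

/-! ### Fields of normal form are symmetries. -/

section Admitted

variable {f g N : ℝ} {U : Set Total}

/-- H along the graph of u is extended from a germ to a global smooth function. First derivatives at
the point suffice, because the component along V enters the linearization only to first order. -/
theorem exists_smooth_conserved (hg : g ≠ 0) (hU : IsOpen U) {H : ℝ × ℝ → ℝ}
    (hH : ContDiffOn ℝ ∞ H (conserved f g N '' U)) (V R : Smooth Base) {m : Total} (hm : m ∈ U)
    (hVR : (ev m.1 V, g * ev m.1 R) = conserved f g N m) :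
    ∃ A : Smooth Base, (∀ᶠ q in nhds m.1, A.1 q = H (V.1 q, g * R.1 q)) ∧
      ∀ i, ev m.1 (D i A) = fderiv ℝ H (conserved f g N m) (1, 0) * ev m.1 (D i V)
        + fderiv ℝ H (conserved f g N m) (0, 1) * (g * ev m.1 (D i R)) := by
  obtain ⟨K, hK, hKH⟩ := exists_contDiff_eventuallyEq (isOpen_image_conserved hg hU) hH
    ⟨m, hm, rfl⟩
  have hj : ContDiff ℝ ∞ fun q : Base => (V.1 q, g * R.1 q) :=
    (Smooth.contDiff V).prodMk (contDiff_const.mul (Smooth.contDiff R))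
  refine ⟨⟨fun q => K (V.1 q, g * R.1 q), hK.comp hj⟩, ?_, fun i => ?_⟩
  · have ht : Filter.Tendsto (fun q : Base => (V.1 q, g * R.1 q)) (nhds m.1)
        (nhds (conserved f g N m)) := by
      have := hj.continuous.continuousAt (x := m.1)
      rwa [ContinuousAt, show (V.1 m.1, g * R.1 m.1) = conserved f g N m from hVR] at this
    exact ht.eventually hKH
  · have h1 : HasFDerivAt K (fderiv ℝ H (conserved f g N m)) (V.1 m.1, g * R.1 m.1) := by
      rw [show (V.1 m.1, g * R.1 m.1) = conserved f g N m from hVR, ← hKH.fderiv_eq]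
      exact ((hK.differentiable (by simp)) _).hasFDerivAt
    have h2 : HasFDerivAt (fun q : Base => (V.1 q, g * R.1 q)) _ m.1 :=
      (Smooth.differentiable V m.1).hasFDerivAt.prodMk
        ((Smooth.differentiable R m.1).hasFDerivAt.const_mul g)
    have h3 := congrArg (fun L : Base →L[ℝ] ℝ => L (Pi.single i 1)) (h1.comp m.1 h2).fderiv
    refine Eq.trans h3 ?_
    have h4 : ((ev m.1 (D i V), g * ev m.1 (D i R)) : ℝ × ℝ)
        = ev m.1 (D i V) • (1, 0) + (g * ev m.1 (D i R)) • (0, 1) := by simp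
    have h5 := congrArg (fderiv ℝ H (conserved f g N m)) h4
    rw [map_add, map_smul, map_smul, smul_eq_mul, smul_eq_mul] at h5
    refine Eq.trans h5 (by ring)

theorem contDiffOn_normalField (hU : IsOpen U) {τ₀ τ₁ α κ s₀ : ℝ} {a b c : ℝ → ℝ}
    {H : ℝ × ℝ → ℝ} (ha : TimeFunction U a) (hb : TimeFunction U b) (hc : TimeFunction U c)
    (hH : ContDiffOn ℝ ∞ H (conserved f g N '' U)) :
    ContDiffOn ℝ ∞ (normalField f g N U τ₀ τ₁ α κ s₀ a b c H) U := by
  have e1 : ∀ j, ContDiffOn ℝ ∞ (fun m : Total => m.1 j) U := fun j =>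
    (baseCoord j).contDiff.contDiffOn
  have e2 : ∀ j, ContDiffOn ℝ ∞ (fun m : Total => m.2 j) U := fun j =>
    (fibreCoord j).contDiff.contDiffOn
  have ha' := ha.contDiffOn_comp
  have hb' := hb.contDiffOn_comp
  have hc' := hc.contDiffOn_comp
  have hb'' := (hb.deriv hU).contDiffOn_comp
  have hc'' := (hc.deriv hU).contDiffOn_comp
  have hH' : ContDiffOn ℝ ∞ (fun m : Total => H (m.2 1 + f * m.1 1, g * m.2 2 - N ^ 2 * m.1 2)) U :=
    hH.comp (conserved f g N).contDiff.contDiffOn fun m hm => ⟨m, hm, rfl⟩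
  have k : ∀ r : ℝ, ContDiffOn ℝ ∞ (fun _ : Total => r) U := fun r => contDiffOn_const
  rw [normalField, field]
  refine ContDiffOn.congr ?_ fun m hm => Set.indicator_of_mem hm _
  have h1 := (((k (α + 2 * τ₁)).mul (e1 1)).add ((k κ).mul (e1 2))).add hb'
  have h2 := (((k (α + 2 * τ₁)).mul (e1 2)).sub ((k κ).mul (e1 1))).add hc'
  refine ContDiffOn.prodMk (contDiffOn_pi.2 fun j => ?_) (contDiffOn_pi.2 fun j => ?_) <;>
    fin_cases j
  · exact (k τ₀).add ((k τ₁).mul (e1 0))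
  · exact h1
  · exact h2
  · exact ((((k (2 * α + 3 * τ₁)).mul (e2 0)).add (hb''.mul (e1 2))).sub (hc''.mul (e1 1))).add ha'
  · exact hH'.sub ((k f).mul h1)
  · exact (((((k α).mul (((k g).mul (e2 2)).sub ((k (N ^ 2)).mul (e1 2)))).add
      ((k (f * κ)).mul ((e2 1).add ((k f).mul (e1 1))))).add (k s₀)).div_const g).add
      ((k (N ^ 2 / g)).mul h2)

-- The terms ξ^j D_j of the equations cancel the top-order terms of the linearization, including the
-- fourth-order derivatives of ψ. What remains is a combination of the equations at p, so their
-- differential consequences are not needed. The conditions on h₁ and h₂ serve only to match the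
-- forcing f V_z in the vorticity equation.
set_option maxHeartbeats 2000000 in
theorem linEqn_normal (hg : g ≠ 0) {τ₀ τ₁ α κ s₀ h₁ h₂ : ℝ} {ψ V R A B G K : Smooth Base}
    {p : Base} (A1 : D 1 A = 0) (A2 : D 2 A = 0) (B1 : D 1 B = 0) (B2 : D 2 B = 0)
    (G1 : D 1 G = 0) (G2 : D 2 G = 0)
    (hDK : ∀ i, ev p (D i K) = h₁ * ev p (D i V) + h₂ * (g * ev p (D i R)))
    (hf1 : f * h₁ = f * α) (hf2 : f * h₂ = -κ) (hE : ∀ k, ev p (eqn f g ψ V R k) = 0)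
    (ξ : Fin 3 → Smooth Base) (ξ0 : ξ 0 = C τ₀ + C τ₁ * coord 0)
    (ξ1 : ξ 1 = C (α + 2 * τ₁) * coord 1 + C κ * coord 2 + B)
    (ξ2 : ξ 2 = C (α + 2 * τ₁) * coord 2 - C κ * coord 1 + G) (k : Fin 3) :
    ev p (linEqn f g ψ V R
        (char ξ (C (2 * α + 3 * τ₁) * ψ + D 0 B * coord 2 - D 0 G * coord 1 + A) ψ)
        (char ξ K V) (char ξ (C α * R + C (f * κ / g) * V + C (s₀ / g)) R) k)
      + (ev p (ξ 0) * ev p (D 0 (eqn f g ψ V R k)) + ev p (ξ 1) * ev p (D 1 (eqn f g ψ V R k))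
        + ev p (ξ 2) * ev p (D 2 (eqn f g ψ V R k))) = 0 := by
  have E0 := hE 0
  have E1 := hE 1
  have E2 := hE 2
  simp [eqn, lap, jac, D_add, ev_C, D_comm21] at E0 E1 E2
  have hfg : g * (f * κ / g) = f * κ := mul_div_cancel₀ _ hg
  fin_cases k
  · simp [linEqn, eqn, char, lap, jac, D_add, D_sub, D_neg, D_mul, D_C, D_coord, ev_C, ev_coord, ξ0, ξ1,
      ξ2, C_zero, C_one, D_comm10, D_comm20, D_comm21, A1, A2, B1, B2, G1, G2, D_zero, D_one, hDK]
    linear_combination (-2 * τ₁) * E0 - ev p (D 2 V) * hf1 - g * ev p (D 2 R) * hf2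
      - ev p (D 1 V) * hfg
  · simp [linEqn, eqn, char, lap, jac, D_add, D_sub, D_neg, D_mul, D_C, D_coord, ev_C, ev_coord, ξ0, ξ1,
      ξ2, C_zero, C_one, D_comm10, D_comm20, D_comm21, A1, A2, B1, B2, G1, G2, D_zero, D_one, hDK]
    linear_combination (h₁ - τ₁) * E1 + g * h₂ * E2
  · simp [linEqn, eqn, char, lap, jac, D_add, D_sub, D_neg, D_mul, D_C, D_coord, ev_C, ev_coord, ξ0, ξ1,
      ξ2, C_zero, C_one, D_comm10, D_comm20, D_comm21, A1, A2, B1, B2, G1, G2, D_zero, D_one]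
    linear_combination f * κ / g * E1 + (α - τ₁) * E2

theorem IsNormal.isAdmitted (hg : g ≠ 0) (hU : IsOpen U) {X : Total → Total}
    (hX : IsNormal f g N U X) : IsAdmitted f g N U X := by
  obtain ⟨τ₀, τ₁, α, κ, s₀, a, b, c, H, ha, hb, hc, hH, hH1, hH2, rfl⟩ := hX
  intro u hu p hp hsol k
  have hu' : ∀ α, ContDiff ℝ ∞ fun q => u q α := fun α => contDiff_pi.1 hu α
  set ψ : Smooth Base := ⟨_, hu' 0⟩ with hψ
  set V : Smooth Base := ⟨_, hu' 1⟩ + C f * coord 1 with hV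
  set R : Smooth Base := ⟨_, hu' 2⟩ - C (N ^ 2 / g) * coord 2 with hR
  have hustate : u = toMap (state f g N ψ V R) := by
    funext q α
    change _ = ev q (state f g N ψ V R α)
    fin_cases α <;> simp [state, hV, hR] <;> rfl
  have evV : ∀ q, ev q V = u q 1 + f * q 1 := fun q => rfl
  have evR : ∀ q, ev q R = u q 2 - N ^ 2 / g * q 2 := fun q => rfl
  have evψ : ∀ q, ev q ψ = u q 0 := fun q => rfl
  have hgR : ∀ q, g * ev q R = g * u q 2 - N ^ 2 * q 2 := fun q => by
    rw [evR]; field_simp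
  clear_value ψ V R
  obtain ⟨A, A1, A2, hA⟩ := ha.exists_smooth hU hp
  obtain ⟨B, B1, B2, hB⟩ := hb.exists_smooth hU hp
  obtain ⟨G, G1, G2, hG⟩ := hc.exists_smooth hU hp
  obtain ⟨K, hK, hDK⟩ := exists_smooth_conserved hg hU hH V R hp
    (Prod.ext (evV p) (hgR p))
  have hf1 := hH1 _ ⟨_, hp, rfl⟩
  have hf2 := hH2 _ ⟨_, hp, rfl⟩
  generalize fderiv ℝ H (conserved f g N (p, u p)) (1, 0) = h₁ at hDK hf1
  generalize fderiv ℝ H (conserved f g N (p, u p)) (0, 1) = h₂ at hDK hf2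
  set ξ : Fin 3 → Smooth Base := ![C τ₀ + C τ₁ * coord 0,
    C (α + 2 * τ₁) * coord 1 + C κ * coord 2 + B, C (α + 2 * τ₁) * coord 2 - C κ * coord 1 + G]
    with hξ
  set φ : Smooth Base := C (2 * α + 3 * τ₁) * ψ + D 0 B * coord 2 - D 0 G * coord 1 + A with hφ
  set S : Smooth Base := C α * R + C (f * κ / g) * V + C (s₀ / g) with hS
  have hin : ∀ᶠ q in nhds p, ((q, u q) : Total) ∈ U :=
    (continuous_id.prodMk hu.continuous).continuousAt.eventually_mem (hU.mem_nhds hp)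
  rw [hustate] at hsol ⊢
  rw [deriv_system_prolong f g N hg _ ψ V R p ξ φ K S]
  · exact linEqn_normal hg A1 A2 B1 B2 G1 G2 hDK hf1 hf2 (hsol.eqn_eq_zero hg) ξ rfl rfl rfl k
  · intro j
    rw [← hustate]
    filter_upwards [hin, hA, hB, hG] with q hq h1 h2 h3
    rw [normalField, field, Set.indicator_of_mem hq, ← ev_apply]
    fin_cases j <;> simp [hξ, ev_C, ev_coord]
    · exact h2.1.symm
    · exact h3.1.symm
  · intro β
    rw [← hustate]
    filter_upwards [hin, hA, hB, hG, hK] with q hq h1 h2 h3 h4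
    rw [normalField, field, Set.indicator_of_mem hq, ← ev_apply]
    simp only [← ev_apply] at h1 h2 h3 h4
    rw [evV, hgR] at h4
    fin_cases β
    · simp [hφ, ev_C, ev_coord, h1, h2, h3, evψ]
    · simp [hξ, ev_C, ev_coord, h2, h4]
    · simp [hξ, hS, ev_C, ev_coord, h3, evV, evR]
      field_simp

end Admitted

/-! ### Fields of normal form constitute a linear space containing the generators. -/

section Span

variable {f g N : ℝ} {U : Set Total}

theorem TimeFunction.const (r : ℝ) : TimeFunction U fun _ => r := contDiffOn_const

theorem TimeFunction.add {a a' : ℝ → ℝ} (h : TimeFunction U a) (h' : TimeFunction U a') :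
    TimeFunction U (fun t => a t + a' t) := ContDiffOn.add h h'

theorem TimeFunction.const_mul {a : ℝ → ℝ} (h : TimeFunction U a) (r : ℝ) :
    TimeFunction U (fun t => r * a t) := contDiffOn_const.mul h

theorem TimeFunction.mul {a a' : ℝ → ℝ} (h : TimeFunction U a) (h' : TimeFunction U a') :
    TimeFunction U (fun t => a t * a' t) := ContDiffOn.mul h h'

theorem TimeFunction.sub {a a' : ℝ → ℝ} (h : TimeFunction U a) (h' : TimeFunction U a') :
    TimeFunction U (fun t => a t - a' t) := ContDiffOn.sub h h'

theorem field_of_mem {c : ℝ → ℝ → ℝ → ℝ → ℝ → ℝ → Total} {m : Total} (hm : m ∈ U) :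
    field U c m = c (m.1 0) (m.1 1) (m.1 2) (m.2 0) (m.2 1) (m.2 2) := Set.indicator_of_mem hm _

theorem field_of_notMem {c : ℝ → ℝ → ℝ → ℝ → ℝ → ℝ → Total} {m : Total} (hm : m ∉ U) :
    field U c m = 0 := Set.indicator_of_notMem hm _

theorem total_ext {p q : Total} (h0 : p.1 0 = q.1 0) (h1 : p.1 1 = q.1 1) (h2 : p.1 2 = q.1 2)
    (h3 : p.2 0 = q.2 0) (h4 : p.2 1 = q.2 1) (h5 : p.2 2 = q.2 2) : p = q := by
  refine Prod.ext (funext fun j => ?_) (funext fun j => ?_) <;> fin_cases j <;> assumption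

theorem normalField_of_mem {τ₀ τ₁ α κ s₀ : ℝ} {a b c : ℝ → ℝ} {H : ℝ × ℝ → ℝ} {m : Total}
    (hm : m ∈ U) : normalField f g N U τ₀ τ₁ α κ s₀ a b c H m =
    (![τ₀ + τ₁ * m.1 0, (α + 2 * τ₁) * m.1 1 + κ * m.1 2 + b (m.1 0),
        (α + 2 * τ₁) * m.1 2 - κ * m.1 1 + c (m.1 0)],
      ![(2 * α + 3 * τ₁) * m.2 0 + deriv b (m.1 0) * m.1 2 - deriv c (m.1 0) * m.1 1 + a (m.1 0),
        H (conserved f g N m) - f * ((α + 2 * τ₁) * m.1 1 + κ * m.1 2 + b (m.1 0)),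
        (α * (g * m.2 2 - N ^ 2 * m.1 2) + f * κ * (m.2 1 + f * m.1 1) + s₀) / g
          + N ^ 2 / g * ((α + 2 * τ₁) * m.1 2 - κ * m.1 1 + c (m.1 0))]) := field_of_mem hm

theorem normalField_of_notMem {τ₀ τ₁ α κ s₀ : ℝ} {a b c : ℝ → ℝ} {H : ℝ × ℝ → ℝ} {m : Total}
    (hm : m ∉ U) : normalField f g N U τ₀ τ₁ α κ s₀ a b c H m = 0 := field_of_notMem hm

theorem IsNormal.add (hg : g ≠ 0) (hU : IsOpen U) {X Y : Total → Total} (hX : IsNormal f g N U X)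
    (hY : IsNormal f g N U Y) : IsNormal f g N U (X + Y) := by
  obtain ⟨τ₀, τ₁, α, κ, s₀, a, b, c, H, ha, hb, hc, hH, hH1, hH2, rfl⟩ := hX
  obtain ⟨τ₀', τ₁', α', κ', s₀', a', b', c', H', ha', hb', hc', hH', hH1', hH2', rfl⟩ := hY
  have hd : ∀ y ∈ conserved f g N '' U,
      fderiv ℝ (fun y => H y + H' y) y = fderiv ℝ H y + fderiv ℝ H' y := fun y hy => by
    have hn := (isOpen_image_conserved hg hU).mem_nhds hy
    exact fderiv_fun_add ((hH.contDiffAt hn).differentiableAt (by simp))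
      ((hH'.contDiffAt hn).differentiableAt (by simp))
  refine ⟨τ₀ + τ₀', τ₁ + τ₁', α + α', κ + κ', s₀ + s₀', _, _, _, fun y => H y + H' y,
    ha.add ha', hb.add hb', hc.add hc', hH.add hH', fun y hy => ?_, fun y hy => ?_, ?_⟩
  · rw [hd y hy, add_apply, mul_add, hH1 y hy, hH1' y hy]; ring
  · rw [hd y hy, add_apply, mul_add, hH2 y hy, hH2' y hy]; ring
  · funext m
    by_cases hm : m ∈ U
    · have db := ((hb.hasDerivAt hU hm).add (hb'.hasDerivAt hU hm)).deriv
      have dc := ((hc.hasDerivAt hU hm).add (hc'.hasDerivAt hU hm)).deriv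
      have db' : deriv (fun t => b t + b' t) (m.1 0) = _ := db
      have dc' : deriv (fun t => c t + c' t) (m.1 0) = _ := dc
      rw [Pi.add_apply, normalField_of_mem hm, normalField_of_mem hm, normalField_of_mem hm,
        db', dc']
      apply total_ext <;> simp <;> ring
    · rw [Pi.add_apply, normalField_of_notMem hm, normalField_of_notMem hm,
        normalField_of_notMem hm, add_zero]

theorem IsNormal.smul (hg : g ≠ 0) (hU : IsOpen U) {X : Total → Total} (hX : IsNormal f g N U X)
    (r : ℝ) : IsNormal f g N U (r • X) := by
  obtain ⟨τ₀, τ₁, α, κ, s₀, a, b, c, H, ha, hb, hc, hH, hH1, hH2, rfl⟩ := hX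
  have hd : ∀ y ∈ conserved f g N '' U,
      fderiv ℝ (fun y => r * H y) y = r • fderiv ℝ H y := fun y hy => by
    have hn := (isOpen_image_conserved hg hU).mem_nhds hy
    exact fderiv_const_mul ((hH.contDiffAt hn).differentiableAt (by simp)) r
  refine ⟨r * τ₀, r * τ₁, r * α, r * κ, r * s₀, _, _, _, fun y => r * H y,
    ha.const_mul r, hb.const_mul r, hc.const_mul r, contDiffOn_const.mul hH, fun y hy => ?_,
    fun y hy => ?_, ?_⟩
  · rw [hd y hy, smul_apply, smul_eq_mul, mul_left_comm, hH1 y hy]; ring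
  · rw [hd y hy, smul_apply, smul_eq_mul, mul_left_comm, hH2 y hy]; ring
  · funext m
    by_cases hm : m ∈ U
    · have db := ((hb.hasDerivAt hU hm).const_mul r).deriv
      have dc := ((hc.hasDerivAt hU hm).const_mul r).deriv
      rw [Pi.smul_apply, normalField_of_mem hm, normalField_of_mem hm, db, dc]
      apply total_ext <;> simp <;> ring
    · rw [Pi.smul_apply, normalField_of_notMem hm, normalField_of_notMem hm, smul_zero]

theorem isNormal_of_eqOn {X : Total → Total} {τ₀ τ₁ α κ s₀ : ℝ} {a b c : ℝ → ℝ} {H : ℝ × ℝ → ℝ}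
    (ha : TimeFunction U a) (hb : TimeFunction U b) (hc : TimeFunction U c)
    (hH : ContDiffOn ℝ ∞ H (conserved f g N '' U))
    (hH1 : ∀ y ∈ conserved f g N '' U, f * fderiv ℝ H y (1, 0) = f * α)
    (hH2 : ∀ y ∈ conserved f g N '' U, f * fderiv ℝ H y (0, 1) = -κ)
    (h0 : ∀ m, m ∉ U → X m = 0)
    (h : ∀ m ∈ U, X m = normalField f g N U τ₀ τ₁ α κ s₀ a b c H m) : IsNormal f g N U X := by
  refine ⟨τ₀, τ₁, α, κ, s₀, a, b, c, H, ha, hb, hc, hH, hH1, hH2, funext fun m => ?_⟩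
  by_cases hm : m ∈ U
  · exact h m hm
  · rw [h0 m hm, normalField_of_notMem hm]

theorem Common.isNormal (hg : g ≠ 0) {X : Total → Total} (hX : Common f g N U X) :
    IsNormal f g N U X := by
  have k := fun r : ℝ => TimeFunction.const (U := U) r
  cases hX with
  | X2 =>
    -- Taking s₀ = g gives coefficient 1 of ∂_ρ after division by g.
    refine isNormal_of_eqOn (τ₀ := 0) (τ₁ := 0) (α := 0) (κ := 0) (s₀ := g) (H := fun _ => 0)
      (k 0) (k 0) (k 0) contDiffOn_const (by simp) (by simp) (fun m => field_of_notMem)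
      fun m hm => ?_
    rw [normalField_of_mem hm, field_of_mem hm]
    apply total_ext <;> simp [hg]
  | X3 a ha =>
    refine isNormal_of_eqOn (τ₀ := 0) (τ₁ := 0) (α := 0) (κ := 0) (s₀ := 0) (H := fun _ => 0)
      ha (k 0) (k 0) contDiffOn_const (by simp) (by simp) (fun m => field_of_notMem)
      fun m hm => ?_
    rw [normalField_of_mem hm, field_of_mem hm]
    apply total_ext <;> simp
  | X4 =>
    refine isNormal_of_eqOn (τ₀ := 1) (τ₁ := 0) (α := 0) (κ := 0) (s₀ := 0) (H := fun _ => 0)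
      (k 0) (k 0) (k 0) contDiffOn_const (by simp) (by simp) (fun m => field_of_notMem)
      fun m hm => ?_
    rw [normalField_of_mem hm, field_of_mem hm]
    apply total_ext <;> simp
  | X5 b hb =>
    refine isNormal_of_eqOn (τ₀ := 0) (τ₁ := 0) (α := 0) (κ := 0) (s₀ := 0) (H := fun _ => 0)
      (k 0) hb (k 0) contDiffOn_const (by simp) (by simp) (fun m => field_of_notMem)
      fun m hm => ?_
    rw [normalField_of_mem hm, field_of_mem hm]
    apply total_ext <;> simp
  | X6 c hc =>
    refine isNormal_of_eqOn (τ₀ := 0) (τ₁ := 0) (α := 0) (κ := 0) (s₀ := 0) (H := fun _ => 0)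
      (k 0) (k 0) hc contDiffOn_const (by simp) (by simp) (fun m => field_of_notMem)
      fun m hm => ?_
    rw [normalField_of_mem hm, field_of_mem hm]
    apply total_ext <;> simp
  | X7 =>
    refine isNormal_of_eqOn (τ₀ := 0) (τ₁ := 0) (α := 1) (κ := 0) (s₀ := 0) (H := Prod.fst)
      (k 0) (k 0) (k 0) contDiff_fst.contDiffOn (by simp [fderiv_fst]) (by simp [fderiv_fst])
      (fun m => field_of_notMem) fun m hm => ?_
    rw [normalField_of_mem hm, field_of_mem hm]
    apply total_ext <;> simp [conserved_apply]
    field_simp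
    ring
  | X8 =>
    refine isNormal_of_eqOn (τ₀ := 0) (τ₁ := 1) (α := 0) (κ := 0) (s₀ := 0) (H := fun _ => 0)
      (k 0) (k 0) (k 0) contDiffOn_const (by simp) (by simp)
      (fun m => field_of_notMem) fun m hm => ?_
    rw [normalField_of_mem hm, field_of_mem hm]
    apply total_ext <;> simp <;> ring

theorem Generator.isNormal (hg : g ≠ 0) (hf : f ≠ 0) {X : Total → Total}
    (hX : Generator f g N U X) : IsNormal f g N U X := by
  have k := fun r : ℝ => TimeFunction.const (U := U) r
  cases hX with
  | X1 =>
    refine isNormal_of_eqOn (τ₀ := 0) (τ₁ := 0) (α := 0) (κ := 0) (s₀ := 0) (H := fun _ => 1)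
      (k 0) (k 0) (k 0) contDiffOn_const (by simp) (by simp) (fun m => field_of_notMem)
      fun m hm => ?_
    rw [normalField_of_mem hm, field_of_mem hm]
    apply total_ext <;> simp
  | common _ hX => exact hX.isNormal hg
  | X9 =>
    have hH : ∀ y : ℝ × ℝ, HasFDerivAt (fun y : ℝ × ℝ => -(1 / f) * y.2)
        (-(1 / f) • ContinuousLinearMap.snd ℝ ℝ ℝ) y := fun y => hasFDerivAt_snd.const_mul _
    refine isNormal_of_eqOn (τ₀ := 0) (τ₁ := 0) (α := 0) (κ := 1) (s₀ := 0)
      (H := fun y => -(1 / f) * y.2) (k 0) (k 0) (k 0)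
      (contDiffOn_const.mul contDiff_snd.contDiffOn) (fun y _ => by rw [(hH y).fderiv]; simp)
      (fun y _ => by rw [(hH y).fderiv]; simp [hf]) (fun m => field_of_notMem) fun m hm => ?_
    rw [normalField_of_mem hm, field_of_mem hm]
    apply total_ext <;> simp [conserved_apply] <;> field_simp <;> ring

theorem conserved_zero_image :
    (fun m : Total => (m.2 1, g * m.2 2 - N ^ 2 * m.1 2)) '' U = conserved 0 g N '' U := by
  refine Set.image_congr fun m _ => ?_
  simp [conserved_apply]

theorem GeneratorZero.isNormal (hg : g ≠ 0) {X : Total → Total}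
    (hX : GeneratorZero g N U X) : IsNormal 0 g N U X := by
  have k := fun r : ℝ => TimeFunction.const (U := U) r
  cases hX with
  | X1 h hh =>
    rw [conserved_zero_image] at hh
    refine isNormal_of_eqOn (τ₀ := 0) (τ₁ := 0) (α := 0) (κ := 0) (s₀ := 0) (H := h)
      (k 0) (k 0) (k 0) hh (by simp) (by simp) (fun m => field_of_notMem)
      fun m hm => ?_
    rw [normalField_of_mem hm, field_of_mem hm]
    apply total_ext <;> simp [conserved_apply]
  | common _ hX => exact hX.isNormal hg

theorem isNormal_zero (hg : g ≠ 0) (hU : IsOpen U) : IsNormal f g N U 0 := by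
  have := (Common.isNormal hg (Common.X4 (f := f) (N := N) (U := U))).smul hg hU 0
  rwa [zero_smul] at this

theorem isNormal_of_mem_algebra (hg : g ≠ 0) (hf : f ≠ 0) (hU : IsOpen U) {X : Total → Total}
    (hX : X ∈ algebra f g N U) : IsNormal f g N U X := by
  induction hX using Submodule.span_induction with
  | mem X hX => exact Generator.isNormal hg hf hX
  | zero => exact isNormal_zero hg hU
  | add X Y _ _ hX hY => exact hX.add hg hU hY
  | smul r X _ hX => exact hX.smul hg hU r

theorem isNormal_of_mem_algebraZero (hg : g ≠ 0) (hU : IsOpen U) {X : Total → Total}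
    (hX : X ∈ algebraZero g N U) : IsNormal 0 g N U X := by
  induction hX using Submodule.span_induction with
  | mem X hX => exact GeneratorZero.isNormal hg hX
  | zero => exact isNormal_zero hg hU
  | add X Y _ _ hX hY => exact hX.add hg hU hY
  | smul r X _ hX => exact hX.smul hg hU r

/-- For `f ≠ 0` the function `H` of a normal form is affine. -/
theorem exists_affine (hg : g ≠ 0) (hU : IsOpen U) (hUc : Convex ℝ U) {α κ : ℝ} {H : ℝ × ℝ → ℝ}
    (hH : ContDiffOn ℝ ∞ H (conserved f g N '' U))
    (hH1 : ∀ y ∈ conserved f g N '' U, f * fderiv ℝ H y (1, 0) = f * α)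
    (hH2 : ∀ y ∈ conserved f g N '' U, f * fderiv ℝ H y (0, 1) = -κ) :
    ∃ μ : ℝ, ∀ y ∈ conserved f g N '' U, f * H y = f * α * y.1 - κ * y.2 + f * μ := by
  -- The claim keeps the factor f so as to cover both cases: for f = 0 the second condition forces κ
  -- = 0, and the identity reads 0 = 0.
  by_cases hf : f = 0
  · refine ⟨0, fun y hy => ?_⟩
    have := hH2 y hy
    rw [hf, zero_mul, zero_eq_neg] at this
    rw [hf, this]; ring
  · have hW := isOpen_image_conserved (f := f) (N := N) hg hU
    have hd : ∀ y ∈ conserved f g N '' U, HasFDerivAt (fun y => f * H y - (f * α * y.1 - κ * y.2))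
        (f • fderiv ℝ H y - ((f * α) • ContinuousLinearMap.fst ℝ ℝ ℝ
          - κ • ContinuousLinearMap.snd ℝ ℝ ℝ)) y := fun y hy =>
      (((hH.contDiffAt (hW.mem_nhds hy)).differentiableAt (by simp)).hasFDerivAt.const_mul f).sub
        ((hasFDerivAt_fst.const_mul _).sub (hasFDerivAt_snd.const_mul _))
    obtain ⟨r, hr⟩ := hW.exists_is_const_of_fderiv_eq_zero
      (hUc.linear_image (conserved f g N : Total →ₗ[ℝ] ℝ × ℝ)).isPreconnected
      (fun y hy => (hd y hy).differentiableAt.differentiableWithinAt) (fun y hy => by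
        rw [(hd y hy).fderiv]
        ext
        · simpa using sub_eq_zero.2 (hH1 y hy)
        · have := hH2 y hy
          simp; linarith)
    refine ⟨r / f, fun y hy => ?_⟩
    rw [mul_div_cancel₀ _ hf]
    linarith [hr y hy]

end Span

/-! ### Decomposition into generators, infinite dimension, and the derivative of the normal form. -/

section Algebra

variable {f g N : ℝ} {U : Set Total}

/-- The common generators account for all the data except κ and the deviation of H from α V. The
remainder Y is left to the two cases: a combination of ∂_v and the rotation for f ≠ 0, a field h ∂_v
for f = 0. -/
theorem IsNormal.mem_span {L : Submodule ℝ (Total → Total)}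
    (hL : ∀ X, Common f g N U X → X ∈ L) {τ₀ τ₁ α κ s₀ : ℝ} {a b c : ℝ → ℝ} {H : ℝ × ℝ → ℝ}
    (ha : TimeFunction U a) (hb : TimeFunction U b) (hc : TimeFunction U c) (hg : g ≠ 0)
    {Y : Total → Total} (hY : Y ∈ L) (hY0 : ∀ m, m ∉ U → Y m = 0)
    (hYU : ∀ m ∈ U, Y m = (![0, κ * m.1 2, -(κ * m.1 1)],
      ![0, H (conserved f g N m) - α * (m.2 1 + f * m.1 1) - f * (κ * m.1 2),
        f * κ * (m.2 1 + f * m.1 1) / g - N ^ 2 / g * (κ * m.1 1)])) :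
    normalField f g N U τ₀ τ₁ α κ s₀ a b c H ∈ L := by
  have key : normalField f g N U τ₀ τ₁ α κ s₀ a b c H =
      τ₀ • field U (fun _ _ _ _ _ _ => (![1, 0, 0], ![0, 0, 0]))
      + τ₁ • field U (fun t x z ψ _ _ =>
        (![t, 2 * x, 2 * z], ![3 * ψ, -(2 * f * x), 2 * (N ^ 2 / g) * z]))
      + α • field U (fun _ x z ψ v ρ => (![0, x, z], ![2 * ψ, v, ρ]))
      + (s₀ / g) • field U (fun _ _ _ _ _ _ => (![0, 0, 0], ![0, 0, 1]))
      + field U (fun t _ _ _ _ _ => (![0, 0, 0], ![a t, 0, 0]))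
      + field U (fun t _ z _ _ _ => (![0, b t, 0], ![deriv b t * z, -(f * b t), 0]))
      + field U (fun t x _ _ _ _ => (![0, 0, c t], ![-(deriv c t * x), 0, N ^ 2 / g * c t]))
      + Y := by
    funext m
    by_cases hm : m ∈ U
    · simp only [Pi.add_apply, Pi.smul_apply, field_of_mem hm, normalField_of_mem hm, hYU m hm]
      apply total_ext <;> simp <;> field_simp <;> ring
    · simp only [Pi.add_apply, Pi.smul_apply, field_of_notMem hm, normalField_of_notMem hm,
        hY0 m hm, smul_zero, add_zero]
  rw [key]
  exact L.add_mem (L.add_mem (L.add_mem (L.add_mem (L.add_mem (L.add_mem (L.add_mem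
    (L.smul_mem _ (hL _ .X4)) (L.smul_mem _ (hL _ .X8))) (L.smul_mem _ (hL _ .X7)))
    (L.smul_mem _ (hL _ .X2))) (hL _ (.X3 a ha))) (hL _ (.X5 b hb))) (hL _ (.X6 c hc))) hY

theorem IsNormal.mem_algebra (hg : g ≠ 0) (hf : f ≠ 0) (hU : IsOpen U) (hUc : Convex ℝ U)
    {X : Total → Total} (hX : IsNormal f g N U X) : X ∈ algebra f g N U := by
  obtain ⟨τ₀, τ₁, α, κ, s₀, a, b, c, H, ha, hb, hc, hH, hH1, hH2, rfl⟩ := hX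
  obtain ⟨μ, hμ⟩ := exists_affine hg hU hUc hH hH1 hH2
  have h1 := (algebra f g N U).smul_mem μ (Submodule.subset_span Generator.X1)
  have h9 := (algebra f g N U).smul_mem κ (Submodule.subset_span Generator.X9)
  refine IsNormal.mem_span (fun X hX => Submodule.subset_span (Generator.common X hX)) ha hb hc
    hg ((algebra f g N U).add_mem h1 h9) (fun m hm => ?_) fun m hm => ?_
  · simp only [Pi.add_apply, Pi.smul_apply, field_of_notMem hm, smul_zero, add_zero]
  · have h2 : H (conserved f g N m) = α * (m.2 1 + f * m.1 1)
        - κ / f * (g * m.2 2 - N ^ 2 * m.1 2) + μ := by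
      have := hμ _ ⟨m, hm, rfl⟩
      rw [conserved_apply] at this ⊢
      field_simp
      linarith
    simp only [Pi.add_apply, Pi.smul_apply, field_of_mem hm, h2]
    apply total_ext <;> simp <;> field_simp <;> ring

theorem IsNormal.mem_algebraZero (hg : g ≠ 0) (hUne : U.Nonempty)
    {X : Total → Total} (hX : IsNormal 0 g N U X) : X ∈ algebraZero g N U := by
  obtain ⟨τ₀, τ₁, α, κ, s₀, a, b, c, H, ha, hb, hc, hH, hH1, hH2, rfl⟩ := hX
  obtain ⟨m₀, hm₀⟩ := hUne
  -- A single point of U suffices to exclude rotation when f = 0.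
  have hκ : κ = 0 := by simpa using hH2 _ ⟨m₀, hm₀, rfl⟩
  have hh : ContDiffOn ℝ ∞ (fun y : ℝ × ℝ => H y - α * y.1)
      ((fun m : Total => (m.2 1, g * m.2 2 - N ^ 2 * m.1 2)) '' U) := by
    rw [conserved_zero_image]
    exact hH.sub (contDiffOn_const.mul contDiff_fst.contDiffOn)
  refine IsNormal.mem_span (fun X hX => Submodule.subset_span (GeneratorZero.common X hX)) ha hb
    hc hg (Submodule.subset_span (GeneratorZero.X1 _ hh)) (fun m hm => field_of_notMem hm)
    fun m hm => ?_
  rw [field_of_mem hm, hκ]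
  apply total_ext <;> simp [conserved_apply]

/-- Polynomials in t embed linearly through a(t) ∂_ψ: the times occurring in U form a nonempty open,
hence infinite, set, on which a nonzero polynomial cannot vanish. -/
theorem not_finiteDimensional_of_common (hU : IsOpen U) (hUne : U.Nonempty)
    {L : Submodule ℝ (Total → Total)} (hL : ∀ X, Common f g N U X → X ∈ L) :
    ¬ FiniteDimensional ℝ L := by
  intro hfin
  let Ψ : Polynomial ℝ →ₗ[ℝ] L :=
    { toFun := fun q => ⟨field U fun t _ _ _ _ _ => (![0, 0, 0], ![q.eval t, 0, 0]),
        hL _ (Common.X3 (fun t => q.eval t)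
          (by simpa [TimeFunction] using (q.contDiff_aeval (𝕜 := ℝ) ∞).contDiffOn))⟩
      map_add' := fun q r => Subtype.ext (funext fun m => by
        by_cases hm : m ∈ U
        · simp only [Submodule.coe_add, Pi.add_apply, field_of_mem hm]
          apply total_ext <;> simp
        · simp only [Submodule.coe_add, Pi.add_apply, field_of_notMem hm, add_zero])
      map_smul' := fun r q => Subtype.ext (funext fun m => by
        by_cases hm : m ∈ U
        · simp only [Submodule.coe_smul, Pi.smul_apply, field_of_mem hm]
          apply total_ext <;> simp
        · simp only [Submodule.coe_smul, Pi.smul_apply, field_of_notMem hm, smul_zero]) }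
  have hΨ : Function.Injective Ψ := by
    rw [← LinearMap.ker_eq_bot, LinearMap.ker_eq_bot']
    intro q hq
    refine Polynomial.eq_zero_of_infinite_isRoot q (Set.Infinite.mono ?_
      (infinite_of_mem_nhds _ ((isOpen_image_time hU).mem_nhds (hUne.image _).some_mem)))
    rintro _ ⟨m, hm, rfl⟩
    have h1 : (field U fun t _ _ _ _ _ => (![0, 0, 0], ![q.eval t, 0, 0])) m = 0 :=
      congrFun (congrArg Subtype.val hq) m
    rw [field_of_mem hm] at h1
    have h2 := congrFun (congrArg Prod.snd h1) 0
    simpa using h2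
  exact Polynomial.not_finite (R := ℝ) (Module.Finite.of_injective Ψ hΨ)

theorem TimeFunction.hasFDerivAt_comp {a : ℝ → ℝ} (ha : TimeFunction U a) (hU : IsOpen U) {m : Total}
    (hm : m ∈ U) : HasFDerivAt (fun q : Total => a (q.1 0)) (_root_.deriv a (m.1 0) • baseCoord 0) m :=
  (ha.hasDerivAt hU hm).comp_hasFDerivAt (f := fun q : Total => q.1 0) m (baseCoord 0).hasFDerivAt

theorem fderiv_normalField (hg : g ≠ 0) (hU : IsOpen U) {τ₀ τ₁ α κ s₀ : ℝ} {a b c : ℝ → ℝ}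
    {H : ℝ × ℝ → ℝ} (ha : TimeFunction U a) (hb : TimeFunction U b) (hc : TimeFunction U c)
    (hH : ContDiffOn ℝ ∞ H (conserved f g N '' U)) {m : Total} (hm : m ∈ U) (w : Total) :
    fderiv ℝ (normalField f g N U τ₀ τ₁ α κ s₀ a b c H) m w =
    (![τ₁ * w.1 0, (α + 2 * τ₁) * w.1 1 + κ * w.1 2 + deriv b (m.1 0) * w.1 0,
        (α + 2 * τ₁) * w.1 2 - κ * w.1 1 + deriv c (m.1 0) * w.1 0],
      ![(2 * α + 3 * τ₁) * w.2 0
          + (deriv b (m.1 0) * w.1 2 + deriv (deriv b) (m.1 0) * w.1 0 * m.1 2)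
          - (deriv c (m.1 0) * w.1 1 + deriv (deriv c) (m.1 0) * w.1 0 * m.1 1)
          + deriv a (m.1 0) * w.1 0,
        fderiv ℝ H (conserved f g N m) (conserved f g N w)
          - f * ((α + 2 * τ₁) * w.1 1 + κ * w.1 2 + deriv b (m.1 0) * w.1 0),
        (α * (g * w.2 2 - N ^ 2 * w.1 2) + f * κ * (w.2 1 + f * w.1 1)) / g
          + N ^ 2 / g * ((α + 2 * τ₁) * w.1 2 - κ * w.1 1 + deriv c (m.1 0) * w.1 0)]) := by
  have hX : DifferentiableAt ℝ (normalField f g N U τ₀ τ₁ α κ s₀ a b c H) m :=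
    ((contDiffOn_normalField hU ha hb hc hH).contDiffAt (hU.mem_nhds hm)).differentiableAt (by simp)
  -- Each component is differentiated separately: near m it agrees with its explicit formula, so
  -- uniqueness of the derivative applies.
  have c1 : ∀ (j : Fin 3) (F : Total → ℝ) (F' : Total →L[ℝ] ℝ), HasFDerivAt F F' m →
      (∀ q ∈ U, (normalField f g N U τ₀ τ₁ α κ s₀ a b c H q).1 j = F q) →
      (fderiv ℝ (normalField f g N U τ₀ τ₁ α κ s₀ a b c H) m w).1 j = F' w := fun j F F' hF he => by
    have h1 := (baseCoord j).hasFDerivAt.comp m hX.hasFDerivAt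
    have h2 := hF.congr_of_eventuallyEq (Filter.eventuallyEq_of_mem (hU.mem_nhds hm) he)
    exact congrArg (fun L : Total →L[ℝ] ℝ => L w) (h1.unique h2)
  have c2 : ∀ (j : Fin 3) (F : Total → ℝ) (F' : Total →L[ℝ] ℝ), HasFDerivAt F F' m →
      (∀ q ∈ U, (normalField f g N U τ₀ τ₁ α κ s₀ a b c H q).2 j = F q) →
      (fderiv ℝ (normalField f g N U τ₀ τ₁ α κ s₀ a b c H) m w).2 j = F' w := fun j F F' hF he => by
    have h1 := (fibreCoord j).hasFDerivAt.comp m hX.hasFDerivAt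
    have h2 := hF.congr_of_eventuallyEq (Filter.eventuallyEq_of_mem (hU.mem_nhds hm) he)
    exact congrArg (fun L : Total →L[ℝ] ℝ => L w) (h1.unique h2)
  have e : ∀ j, HasFDerivAt (fun q : Total => q.1 j) (baseCoord j) m := fun j =>
    (baseCoord j).hasFDerivAt
  have e' : ∀ j, HasFDerivAt (fun q : Total => q.2 j) (fibreCoord j) m := fun j =>
    (fibreCoord j).hasFDerivAt
  have da := TimeFunction.hasFDerivAt_comp ha hU hm
  have db := TimeFunction.hasFDerivAt_comp hb hU hm
  have dc := TimeFunction.hasFDerivAt_comp hc hU hm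
  have db' := TimeFunction.hasFDerivAt_comp (hb.deriv hU) hU hm
  have dc' := TimeFunction.hasFDerivAt_comp (hc.deriv hU) hU hm
  have dH : HasFDerivAt (fun q => H (conserved f g N q))
      ((fderiv ℝ H (conserved f g N m)).comp (conserved f g N)) m :=
    ((hH.contDiffAt ((isOpen_image_conserved hg hU).mem_nhds ⟨m, hm, rfl⟩)).differentiableAt
      (by simp)).hasFDerivAt.comp m (conserved f g N).hasFDerivAt
  have d1 := (((e 1).const_mul (α + 2 * τ₁)).add ((e 2).const_mul κ)).add db
  have d2 := (((e 2).const_mul (α + 2 * τ₁)).sub ((e 1).const_mul κ)).add dc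
  have d3 := ((((e' 0).const_mul (2 * α + 3 * τ₁)).add (db'.mul (e 2))).sub (dc'.mul (e 1))).add da
  have d5 := ((((((e' 2).const_mul g).sub ((e 2).const_mul (N ^ 2))).const_mul α).add
    (((e' 1).add ((e 1).const_mul f)).const_mul (f * κ))).add_const s₀).mul_const g⁻¹
  apply total_ext
  · refine (c1 0 _ _ (((e 0).const_mul τ₁).const_add τ₀) fun q hq => ?_).trans ?_
    · simp [normalField_of_mem hq]
    · simp [baseCoord_apply]
  · refine (c1 1 _ _ d1 fun q hq => ?_).trans ?_
    · simp [normalField_of_mem hq]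
    · simp [baseCoord_apply]
  · refine (c1 2 _ _ d2 fun q hq => ?_).trans ?_
    · simp [normalField_of_mem hq]
    · simp [baseCoord_apply]
  · refine (c2 0 _ _ d3 fun q hq => ?_).trans ?_
    · simp [normalField_of_mem hq]
    · simp [baseCoord_apply, fibreCoord_apply]; ring
  · refine (c2 1 _ _ (dH.sub (d1.const_mul f)) fun q hq => ?_).trans ?_
    · simp [normalField_of_mem hq]
    · simp [baseCoord_apply]; ring
  · refine (c2 2 _ _ (d5.add (d2.const_mul (N ^ 2 / g))) fun q hq => ?_).trans ?_
    · simp [normalField_of_mem hq, div_eq_mul_inv]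
    · simp [baseCoord_apply, fibreCoord_apply, div_eq_mul_inv]; ring

end Algebra

/-! ### Closure under the commutator. -/

section Bracket

variable {f g N : ℝ} {U : Set Total}

/-- The images under `conserved` of the values of a vector field of normal form. -/
theorem conserved_normalField (hg : g ≠ 0) {τ₀ τ₁ α κ s₀ : ℝ} {a b c : ℝ → ℝ}
    {H : ℝ × ℝ → ℝ} {m : Total} (hm : m ∈ U) :
    conserved f g N (normalField f g N U τ₀ τ₁ α κ s₀ a b c H m) =
      (H (conserved f g N m),
        α * (conserved f g N m).2 + f * κ * (conserved f g N m).1 + s₀) := by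
  rw [normalField_of_mem hm]
  refine Prod.ext ?_ ?_
  · simp [conserved_apply]
  · simp [conserved_apply]
    field_simp
    ring

/-- The dilations and the rotation commute in their linear parts, so the bracket has τ₁ = α = κ = 0.
The field also projects to the plane of conserved quantities, as (H, α y₂ + f κ y₁ + s), and the new
H is the first component of the bracket of the projected fields. -/
theorem IsNormal.lieBracket (hg : g ≠ 0) (hU : IsOpen U) (hUc : Convex ℝ U) {X Y : Total → Total}
    (hX : IsNormal f g N U X) (hY : IsNormal f g N U Y) :
    IsNormal f g N U (VectorField.lieBracket ℝ X Y) := by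
  obtain ⟨τ, τ', α, κ, s, a, b, c, H, ha, hb, hc, hH, hH1, hH2, rfl⟩ := hX
  obtain ⟨θ, θ', β, ν, r, a₂, b₂, c₂, K, ha₂, hb₂, hc₂, hK, hK1, hK2, rfl⟩ := hY
  obtain ⟨μ, hμ⟩ := exists_affine hg hU hUc hH hH1 hH2
  obtain ⟨χ, hχ⟩ := exists_affine hg hU hUc hK hK1 hK2
  have hW := isOpen_image_conserved (f := f) (N := N) hg hU
  have aff : ∀ x y : ℝ, TimeFunction U fun t => x + y * t := fun x y =>
    contDiffOn_const.add (contDiffOn_const.mul contDiffOn_id)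
  let L : ℝ × ℝ → ℝ := fun y => fderiv ℝ K y (H y, α * y.2 + f * κ * y.1 + s)
    - fderiv ℝ H y (K y, β * y.2 + f * ν * y.1 + r)
  have lin : ∀ x y z : ℝ, ContDiff ℝ ∞ fun p : ℝ × ℝ => x * p.2 + f * y * p.1 + z :=
    fun x y z => by fun_prop
  have hL : ContDiffOn ℝ ∞ L (conserved f g N '' U) :=
    ((hK.fderiv_of_isOpen hW (by simp)).clm_apply (hH.prodMk (lin α κ s).contDiffOn)).sub
      ((hH.fderiv_of_isOpen hW (by simp)).clm_apply (hK.prodMk (lin β ν r).contDiffOn))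
  have split : ∀ (A : ℝ × ℝ →L[ℝ] ℝ) (p q : ℝ), f * A (p, q) = f * A (1, 0) * p
      + f * A (0, 1) * q := fun A p q => by
    have : ((p, q) : ℝ × ℝ) = p • (1, 0) + q • (0, 1) := by simp
    rw [this, map_add, map_smul, map_smul, smul_eq_mul, smul_eq_mul]
    ring
  -- Since f H and f K are affine with the prescribed slopes, the nonconstant terms of f L cancel.
  -- This gives the normal-form conditions on L with α = κ = 0.
  have hLc : ∀ y ∈ conserved f g N '' U,
      f * L y = f * (β * μ - α * χ) - (ν * s - κ * r) := fun y hy => by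
    have h1 := hμ y hy
    have h2 := hχ y hy
    simp only [L]
    rw [mul_sub, split (fderiv ℝ K y) (H y), split (fderiv ℝ H y) (K y), hH1 y hy, hH2 y hy, hK1 y hy, hK2 y hy]
    linear_combination β * h1 - α * h2
  have hLd : ∀ y ∈ conserved f g N '' U, ∀ w, f * fderiv ℝ L y w = 0 := fun y hy w => by
    have h1 := (((hL.contDiffAt (hW.mem_nhds hy)).differentiableAt
      (by simp)).hasFDerivAt.const_mul f)
    have h2 := (hasFDerivAt_const (𝕜 := ℝ) (f * (β * μ - α * χ) - (ν * s - κ * r))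
      y).congr_of_eventuallyEq (Filter.eventuallyEq_of_mem (hW.mem_nhds hy) hLc)
    exact congrArg (fun A : ℝ × ℝ →L[ℝ] ℝ => A w) (h1.unique h2)
  refine isNormal_of_eqOn (τ₀ := τ * θ' - θ * τ') (τ₁ := 0) (α := 0) (κ := 0)
    (s₀ := β * s - α * r + f * (ν * μ - κ * χ)) (H := L)
    (a := fun t => ((τ + τ' * t) * deriv a₂ t + (2 * β + 3 * θ') * a t
        + (c t * deriv b₂ t - b t * deriv c₂ t))
      - ((θ + θ' * t) * deriv a t + (2 * α + 3 * τ') * a₂ t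
        + (c₂ t * deriv b t - b₂ t * deriv c t)))
    (b := fun t => ((τ + τ' * t) * deriv b₂ t + (β + 2 * θ') * b t + ν * c t)
      - ((θ + θ' * t) * deriv b t + (α + 2 * τ') * b₂ t + κ * c₂ t))
    (c := fun t => ((τ + τ' * t) * deriv c₂ t + (β + 2 * θ') * c t - ν * b t)
      - ((θ + θ' * t) * deriv c t + (α + 2 * τ') * c₂ t - κ * b₂ t))
    (((((aff τ τ').mul (ha₂.deriv hU)).add (ha.const_mul _)).add
      ((hc.mul (hb₂.deriv hU)).sub (hb.mul (hc₂.deriv hU)))).sub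
      ((((aff θ θ').mul (ha.deriv hU)).add (ha₂.const_mul _)).add
      ((hc₂.mul (hb.deriv hU)).sub (hb₂.mul (hc.deriv hU)))))
    (((((aff τ τ').mul (hb₂.deriv hU)).add (hb.const_mul _)).add (hc.const_mul _)).sub
      ((((aff θ θ').mul (hb.deriv hU)).add (hb₂.const_mul _)).add (hc₂.const_mul _)))
    (((((aff τ τ').mul (hc₂.deriv hU)).add (hc.const_mul _)).sub (hb.const_mul _)).sub
      ((((aff θ θ').mul (hc.deriv hU)).add (hc₂.const_mul _)).sub (hb₂.const_mul _)))
    hL (fun y hy => by rw [hLd y hy, mul_zero]) (fun y hy => by rw [hLd y hy, neg_zero])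
    (fun m hm => ?_) fun m hm => ?_
  · rw [VectorField.lieBracket, normalField_of_notMem hm, normalField_of_notMem hm, map_zero,
      map_zero, sub_zero]
  · have d0 : ∀ x y : ℝ, HasDerivAt (fun t => x + y * t) y (m.1 0) := fun x y => by
      simpa using ((hasDerivAt_id (m.1 0)).const_mul y).const_add x
    have db := hb.hasDerivAt hU hm
    have dc := hc.hasDerivAt hU hm
    have db₂ := hb₂.hasDerivAt hU hm
    have dc₂ := hc₂.hasDerivAt hU hm
    have db' := (hb.deriv hU).hasDerivAt hU hm
    have dc' := (hc.deriv hU).hasDerivAt hU hm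
    have db₂' := (hb₂.deriv hU).hasDerivAt hU hm
    have dc₂' := (hc₂.deriv hU).hasDerivAt hU hm
    have eb := (((((d0 τ τ').fun_mul db₂').fun_add (db.const_mul (β + 2 * θ'))).fun_add
      (dc.const_mul ν)).fun_sub ((((d0 θ θ').fun_mul db').fun_add
      (db₂.const_mul (α + 2 * τ'))).fun_add (dc₂.const_mul κ))).deriv
    have ec := (((((d0 τ τ').fun_mul dc₂').fun_add (dc.const_mul (β + 2 * θ'))).fun_sub
      (db.const_mul ν)).fun_sub ((((d0 θ θ').fun_mul dc').fun_add
      (dc₂.const_mul (α + 2 * τ'))).fun_sub (db₂.const_mul κ))).deriv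
    rw [VectorField.lieBracket, fderiv_normalField hg hU ha hb hc hH hm,
      fderiv_normalField hg hU ha₂ hb₂ hc₂ hK hm, conserved_normalField hg hm,
      conserved_normalField hg hm, normalField_of_mem hm, normalField_of_mem hm,
      normalField_of_mem hm, eb, ec]
    have h1 := hμ _ ⟨m, hm, rfl⟩
    have h2 := hχ _ ⟨m, hm, rfl⟩
    rw [conserved_apply] at h1 h2 ⊢
    apply total_ext
    · simp; ring
    · simp; ring
    · simp; ring
    · simp; ring
    · simp [L]; ring
    · simp
      field_simp
      -- In the ρ-component H and K occur only multiplied by f, so their affine expressions turn it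
      -- into the constant chosen as s₀.
      linear_combination ν * h1 - κ * h2

theorem IsNormal.mem_symmetryAlgebra (hg : g ≠ 0) (hU : IsOpen U) {X : Total → Total}
    (hX : IsNormal f g N U X) : X ∈ symmetryAlgebra f g N U := by
  refine ⟨?_, ?_, hX.isAdmitted hg hU⟩
  · obtain ⟨τ, τ', α, κ, s, a, b, c, H, ha, hb, hc, hH, -, -, rfl⟩ := hX
    exact contDiffOn_normalField hU ha hb hc hH
  · obtain ⟨τ, τ', α, κ, s, a, b, c, H, -, -, -, -, -, -, rfl⟩ := hX
    exact fun m hm => normalField_of_notMem hm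

/-- A linear space which consists of the vector fields of normal form is the symmetry algebra, and
it is an infinite-dimensional Lie algebra. -/
theorem symmetryAlgebra_eq_of_mem_iff (hg : g ≠ 0) (hU : IsOpen U) (hUc : Convex ℝ U)
    (hUne : U.Nonempty) {L : Submodule ℝ (Total → Total)}
    (hL : ∀ X, X ∈ L ↔ IsNormal f g N U X) :
    symmetryAlgebra f g N U = L ∧ IsInfiniteLieAlgebra L := by
  refine ⟨Set.ext fun X => ⟨fun h => (hL X).2 (h.2.2.isNormal hg hU hUc h.1 h.2.1),
    fun h => ((hL X).1 h).mem_symmetryAlgebra hg hU⟩, fun X hX Y hY =>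
    (hL _).2 (((hL X).1 hX).lieBracket hg hU hUc ((hL Y).1 hY)),
    not_finiteDimensional_of_common hU hUne fun X hX => (hL X).2 (hX.isNormal hg)⟩

end Bracket

end InternalWaves

theorem mainTheorem3 (f g N : ℝ) (hg : g ≠ 0)
    (U : Set InternalWaves.Total) (hUo : IsOpen U) (hUc : Convex ℝ U) (hUne : U.Nonempty) :
    (f ≠ 0 →
      InternalWaves.symmetryAlgebra f g N U = InternalWaves.algebra f g N U ∧
      InternalWaves.IsInfiniteLieAlgebra (InternalWaves.algebra f g N U)) ∧
    (f = 0 →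
      InternalWaves.symmetryAlgebra f g N U = InternalWaves.algebraZero g N U ∧
      InternalWaves.IsInfiniteLieAlgebra (InternalWaves.algebraZero g N U)) := by
  refine ⟨fun hf => ?_, fun hf => ?_⟩
  · exact InternalWaves.symmetryAlgebra_eq_of_mem_iff hg hUo hUc hUne fun X =>
      ⟨InternalWaves.isNormal_of_mem_algebra hg hf hUo,
        InternalWaves.IsNormal.mem_algebra hg hf hUo hUc⟩
  · subst hf
    exact InternalWaves.symmetryAlgebra_eq_of_mem_iff hg hUo hUc hUne fun X =>
      ⟨InternalWaves.isNormal_of_mem_algebraZero hg hUo,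
        InternalWaves.IsNormal.mem_algebraZero hg hUne⟩
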